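/- Let $n$ be a positive integer such that there is a Hadamard matrix of order $2n$ and $p=2n-1$ is a prime power. Write $I_k$ and $J_k$ for the identity and the all-ones matrix of order $k$. A $BGW(v,k,\lambda)$ over a finite group $G$ is a $v\times v$ matrix $W=[w_{ij}]$ with entries in $G\cup\{0\}$ such that each row has exactly $k$ nonzero entries and, for any two distinct rows $i,i'$, every element of $G$ occurs exactly $\lambda/|G|$ times in the multiset $\{w_{ij}w_{i'j}^{-1} : w_{ij}\ne0\ne w_{i'j}\}$. Let $N$ be the negacyclic shift matrix of order $2n$ (ones on the superdiagonal, $-1$ in the lower left corner, zeros elsewhere), and let $g=N\otimes I_{2n}$, which generates a cyclic group of order $4n$ with $g^{2n}=-I$. A BGW over $\langle g\rangle$ is skew if $w_{ji}=-w_{ij}$ for all $i,j$. Let $K$ be any Hadamard matrix of order $2n$. Negate columns of $K$ so that its first row is all ones, let $h_1,\dots,h_{2n}$ be the resulting rows and put $C_k=h_k^Th_k$. Let $H=\sum_{k=2}^{2n}N^{k-1}\otimes C_k$ be the block negacirculant matrix with first block row $(0,C_2,\dots,C_{2n})$, and let $R=R_{2n}\otimes I_{2n}$, where $R_{2n}$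 is the back identity matrix (ones on the antidiagonal, zeros elsewhere). Then there exists a skew $BGW(p^2+1,p^2,p^2-1)$ over $\langle g\rangle$. Moreover, for every such matrix $W=[w_{ij}]$, let $A_1$ (the plus twin) and $A_2$ (the minus twin) be the $(0,1)$-matrices of order $4n^2(p^2+1)$ marking the positions of the entries $1$, respectively $-1$, of the block matrix $[Hw_{ij}R]$, and let $$A_0=I_{4n^2(p^2+1)},\quad A_4=I_{2n(p^2+1)}\otimes(J_{2n}-I_{2n}),\quad A_5=I_{p^2+1}\otimes(J_{4n^2}-I_{2n}\otimes J_{2n}),$$ $$J=J_{4n^2(p^2+1)},\qquad A_3=J-A_0-A_1-A_2-A_4-A_5.$$ Then $\{A_0,\dots,A_5\}$ is a nonsymmetric commutative association scheme of class $5$: the $A_i$ are nonzero $(0,1)$-matrices, $A_0=I$, $\sum_iA_i=J$, each $A_i^T$ is some $A_j$, each $A_iA_j$ is a linear combination of the $A_k$, $A_iA_j=A_jA_i$, and not all $A_i$ are symmetric. Furthermore $A_1^T=A_2$, the matrices $A_3,A_4,A_5$ are symmetric, and the intersection numbers are given by: - $A_1A_1=A_2A_2=(n-1)(2n-1)(2n^2-n)(A_1+A_2+A_3+A_5)+n^2(2n-1)^2A_4$;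 - $A_1A_2=n^2(2n-1)^2A_0+(2n-1)^2(n^2-n)J$; - $A_1A_3=A_2A_3=2n(n-1)(2n-1)(A_1+A_2+A_3)+n(2n-1)^2A_5$; - $A_1A_4=(n-1)A_1+nA_2$; - $A_1A_5=A_2A_5=2n(n-1)(A_1+A_2)+n(2n-1)A_3$; - $A_2A_4=nA_1+(n-1)A_2$; - $A_3A_3=2n(2n-1)^2A_0+4n(n-1)(A_1+A_2+A_3)+2n(2n-1)^2A_4$; - $A_3A_4=(2n-1)A_3$; - $A_3A_5=2n(A_1+A_2)$; - $A_4A_4=(2n-1)A_0+(2n-2)A_4$; - $A_4A_5=(2n-1)A_5$; - $A_5A_5=2n(2n-1)A_0+2n(2n-1)A_4+4n(n-1)A_5$. -/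

import Mathlib

open scoped Kronecker Matrix

/-- The all-ones square matrix `J` indexed by `X`. -/
def allOnes (X : Type*) : Matrix X X ℤ := Matrix.of fun _ _ => 1

/-- The family `A 0, …, A d` of matrices indexed by `X` is a commutative association scheme of
class `d` with vertex set `X`. -/
structure IsAssociationScheme {X : Type*} [Fintype X] [DecidableEq X] (d : ℕ)
    (A : Fin (d + 1) → Matrix X X ℤ) : Prop where
  zero_one : ∀ i x y, A i x y = 0 ∨ A i x y = 1
  ne_zero : ∀ i, A i ≠ 0
  zero_eq_one : A 0 = 1
  sum_eq : ∑ i, A i = allOnes X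
  transpose_mem : ∀ i, ∃ j, (A i)ᵀ = A j
  mul_mem : ∀ i j, ∃ c : Fin (d + 1) → ℤ, A i * A j = ∑ k, c k • A k
  comm : ∀ i j, A i * A j = A j * A i

/-- The association scheme is nonsymmetric: not all its adjacency matrices are symmetric. -/
def IsNonsymmetric {X : Type*} {d : ℕ} (A : Fin (d + 1) → Matrix X X ℤ) : Prop :=
  ¬ ∀ i, (A i).IsSymm

/-- `W` is a balanced generalized weighing matrix `BGW(v, k, l)` over the finite group `G`: a matrix
of order `v` with entries in `G ∪ {0}`, with exactly `k` nonzero entries in each row, and such that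
for distinct rows `i`, `i'` every element of `G` occurs exactly `l / |G|` times in the multiset of
the quotients `W i j * (W i' j)⁻¹`, over all `j` for which both entries are nonzero. -/
structure IsBGW {ι G : Type*} [Fintype ι] [Group G] (v k l : ℕ)
    (W : Matrix ι ι (WithZero G)) : Prop where
  order : Fintype.card ι = v
  weight : ∀ i, {j | W i j ≠ 0}.ncard = k
  balanced : ∀ i i', i ≠ i' → ∀ g : G,
    Nat.card G * {j | W i j ≠ 0 ∧ W i' j ≠ 0 ∧ W i j * (W i' j)⁻¹ = (g : WithZero G)}.ncard = l

/-- `W i j = -W j i` for all `i, j`, where `neg`, an element of order two of `G`, is the element that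
plays the role of `-1`. (This forces the diagonal of `W` to be zero.) -/
def IsSkewBGW {ι G : Type*} [Group G] (neg : G) (W : Matrix ι ι (WithZero G)) : Prop :=
  ∀ i j, W j i = (neg : WithZero G) * W i j

/-- The cyclic group of order `4n`, written multiplicatively. -/
abbrev Cyc (n : ℕ) : Type := Multiplicative (ZMod (4 * n))

/-- The element of order two in the cyclic group of order `4n` (for `0 < n`). -/
def cycNeg (n : ℕ) : Cyc n := Multiplicative.ofAdd ((2 * n : ℕ) : ZMod (4 * n))

/-- The negacyclic shift of order `2n`: ones on the superdiagonal, `-1` in the lower left corner.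
Its `2n`-th power is `-I`. -/
def negaShift (n : ℕ) : Matrix (Fin (2 * n)) (Fin (2 * n)) ℤ :=
  Matrix.of fun i j =>
    if (i : ℕ) + 1 = j then 1 else if (i : ℕ) + 1 = 2 * n ∧ (j : ℕ) = 0 then -1 else 0

/-- The generator `g` of the cyclic matrix group of order `4n`: the block negacyclic shift with
blocks of order `2n`. -/
def blockShift (n : ℕ) : Matrix (Fin (2 * n) × Fin (2 * n)) (Fin (2 * n) × Fin (2 * n)) ℤ :=
  negaShift n ⊗ₖ (1 : Matrix (Fin (2 * n)) (Fin (2 * n)) ℤ)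

/-- The matrix of order `4n²` denoted by an element of `G ∪ {0}`, `G` being the cyclic group of order
`4n`: the residue `a` denotes `g ^ a`, and `0` denotes the zero matrix. -/
noncomputable def cycMatrix (n : ℕ) :
    WithZero (Cyc n) → Matrix (Fin (2 * n) × Fin (2 * n)) (Fin (2 * n) × Fin (2 * n)) ℤ :=
  WithZero.recZeroCoe 0 (fun a => blockShift n ^ (Multiplicative.toAdd a).val)

/-- The Hadamard matrix `K` with columns negated so that its first row is all ones. -/
def normalizeHadamard {n : ℕ} [NeZero n] (K : Matrix (Fin (2 * n)) (Fin (2 * n)) ℤ) :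
    Matrix (Fin (2 * n)) (Fin (2 * n)) ℤ :=
  Matrix.of fun i j => K i j * K 0 j

/-- `C_k = h_kᵀ h_k`, where `h_k` is the `k`-th row of the normalized Hadamard matrix. Rows are
numbered from `0`, so `hadamardC K 0` is the all-ones matrix. -/
def hadamardC {n : ℕ} [NeZero n] (K : Matrix (Fin (2 * n)) (Fin (2 * n)) ℤ) (k : Fin (2 * n)) :
    Matrix (Fin (2 * n)) (Fin (2 * n)) ℤ :=
  Matrix.vecMulVec (normalizeHadamard K k) (normalizeHadamard K k)

/-- The block negacirculant matrix of order `4n²` with first block row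
`(0, hadamardC K 1, …, hadamardC K (2n - 1))`. -/
def blockNegacirculant {n : ℕ} [NeZero n] (K : Matrix (Fin (2 * n)) (Fin (2 * n)) ℤ) :
    Matrix (Fin (2 * n) × Fin (2 * n)) (Fin (2 * n) × Fin (2 * n)) ℤ :=
  ∑ k ∈ Finset.univ.erase (0 : Fin (2 * n)), (negaShift n ^ (k : ℕ)) ⊗ₖ hadamardC K k

/-- `R = R_{2n} ⊗ I_{2n}`, where `R_{2n}` is the back identity matrix. -/
def backIdentity (n : ℕ) : Matrix (Fin (2 * n) × Fin (2 * n)) (Fin (2 * n) × Fin (2 * n)) ℤ :=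
  (Matrix.of fun i j : Fin (2 * n) => if j = i.rev then (1 : ℤ) else 0) ⊗ₖ
    (1 : Matrix (Fin (2 * n)) (Fin (2 * n)) ℤ)

/-- The vertex set, of size `4n²(p² + 1)`. -/
abbrev Vertex (n p : ℕ) : Type := Fin (p ^ 2 + 1) × (Fin (2 * n) × Fin (2 * n))

/-- The block matrix `[H w_{ij} R]`, with entries in `{0, 1, -1}`. -/
noncomputable def twinMatrix {n p : ℕ} [NeZero n] (K : Matrix (Fin (2 * n)) (Fin (2 * n)) ℤ)
    (W : Matrix (Fin (p ^ 2 + 1)) (Fin (p ^ 2 + 1)) (WithZero (Cyc n))) :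
    Matrix (Vertex n p) (Vertex n p) ℤ :=
  Matrix.of fun x y =>
    (blockNegacirculant K * cycMatrix n (W x.1 y.1) * backIdentity n) x.2 y.2

/-- The plus twin `A₁`: the positions of the entries `1` of `[H w_{ij} R]`. -/
noncomputable def plusTwin {n p : ℕ} [NeZero n] (K : Matrix (Fin (2 * n)) (Fin (2 * n)) ℤ)
    (W : Matrix (Fin (p ^ 2 + 1)) (Fin (p ^ 2 + 1)) (WithZero (Cyc n))) :
    Matrix (Vertex n p) (Vertex n p) ℤ :=
  Matrix.of fun x y => if twinMatrix K W x y = 1 then 1 else 0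

/-- The minus twin `A₂`: the positions of the entries `-1` of `[H w_{ij} R]`. -/
noncomputable def minusTwin {n p : ℕ} [NeZero n] (K : Matrix (Fin (2 * n)) (Fin (2 * n)) ℤ)
    (W : Matrix (Fin (p ^ 2 + 1)) (Fin (p ^ 2 + 1)) (WithZero (Cyc n))) :
    Matrix (Vertex n p) (Vertex n p) ℤ :=
  Matrix.of fun x y => if twinMatrix K W x y = -1 then 1 else 0

/-- `A₄ = I_{2n(p²+1)} ⊗ (J_{2n} - I_{2n})`. -/
def matA4 (n p : ℕ) : Matrix (Vertex n p) (Vertex n p) ℤ :=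
  (1 : Matrix (Fin (p ^ 2 + 1)) (Fin (p ^ 2 + 1)) ℤ) ⊗ₖ
    ((1 : Matrix (Fin (2 * n)) (Fin (2 * n)) ℤ) ⊗ₖ (allOnes (Fin (2 * n)) - 1))

/-- `A₅ = I_{p²+1} ⊗ (J_{4n²} - I_{2n} ⊗ J_{2n})`. -/
def matA5 (n p : ℕ) : Matrix (Vertex n p) (Vertex n p) ℤ :=
  (1 : Matrix (Fin (p ^ 2 + 1)) (Fin (p ^ 2 + 1)) ℤ) ⊗ₖ
    (allOnes (Fin (2 * n) × Fin (2 * n)) -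
      (1 : Matrix (Fin (2 * n)) (Fin (2 * n)) ℤ) ⊗ₖ allOnes (Fin (2 * n)))

/-- `A₃ = J - I - A₁ - A₂ - A₄ - A₅`. -/
noncomputable def matA3 {n p : ℕ} [NeZero n] (K : Matrix (Fin (2 * n)) (Fin (2 * n)) ℤ)
    (W : Matrix (Fin (p ^ 2 + 1)) (Fin (p ^ 2 + 1)) (WithZero (Cyc n))) :
    Matrix (Vertex n p) (Vertex n p) ℤ :=
  allOnes (Vertex n p) - 1 - plusTwin K W - minusTwin K W - matA4 n p - matA5 n p

/-! ### Existence of the skew BGW from determinants on a projective line. -/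

section Existence

/-! Existence. Over the field of order p², the determinants of pairs of points of the projective
line form an alternating matrix. By the Plücker relation, for two distinct rows the quotient of the
entries takes every unit exactly once as the column runs over the other points. A surjection of the
unit group onto the cyclic group of order 4n turns this matrix into a BGW (`isBGW_projDet`). It is
skew once -1 maps to the involution, which works because the Hadamard matrix forces n to be even
(`exists_unitHom_cyc`).

Scheme. Let T be the signed matrix [H w R], Z the zero pattern of its off-diagonal blocks, and L, M
the block diagonal matrices with all-ones blocks of order 2n and 4n². Then A₁ + A₂ = J - M - Z, A₁ -
A₂ = T, A₃ = Z, A₄ = L - I and A₅ = M - L, so everything follows from the products of T, Z, L, M, J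
(`TwinRelations`).

Conjugation by R inverts the shift, so the product of the blocks of a and b depends only on a b⁻¹
(`twinBlock_mul_twinBlock`, `zeroBlock_mul_zeroBlock`). Skewness exchanges the indices of the second
factor, so a block of T² or Z² is a sum over quotients of two rows of W, and for distinct rows
balance makes it a multiple of the sum over the whole group. That sum is 0 for the negacyclic shift
and 2J for the cyclic one. Since the all-ones row of the normalized Hadamard matrix is left out of
H, T annihilates Z, L, M and J. Both A₁ and A₂ are halves of integer combinations, so the table is
proved after doubling (`TwinRelations.table`). -/

/-- The determinant of the homogeneous coordinates of two points of the projective line, where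
`some a` has the coordinates `(1, a)` and `none` the coordinates `(0, 1)`. -/
def projDet {F : Type*} [Field F] (x y : Option F) : F :=
  (x.elim 0 fun _ => 1) * y.elim 1 id - x.elim 1 id * (y.elim 0 fun _ => 1)

theorem projDet_eq_zero {F : Type*} [Field F] {x y : Option F} : projDet x y = 0 ↔ x = y := by
  cases x <;> cases y <;> simp [projDet, sub_eq_zero, eq_comm]

theorem projDet_swap {F : Type*} [Field F] (x y : Option F) : projDet y x = -projDet x y := by
  simp only [projDet]; ring

/-- This identity is what makes the quotient of two rows injective in the column. -/
theorem projDet_plucker {F : Type*} [Field F] (x x' y y' : Option F) :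
    projDet x y * projDet x' y' - projDet x y' * projDet x' y = projDet x x' * projDet y y' := by
  simp only [projDet]; ring

/-- Extension by zero of a homomorphism from the unit group of a field. -/
noncomputable def unitHomWithZero {F G : Type*} [Field F] [Group G] (φ : Fˣ →* G) :
    F →*₀ WithZero G := by
  classical
  exact (WithZero.map' φ).comp (.ofClass (WithZero.withZeroUnitsEquiv (G := F)).symm)

theorem unitHomWithZero_unit {F G : Type*} [Field F] [Group G] (φ : Fˣ →* G) (u : Fˣ) :
    unitHomWithZero φ (u : F) = (φ u : WithZero G) := by
  classical
  simp [unitHomWithZero]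

/-- The fibers are cosets of the kernel. This transfers balance from the unit group to its quotient.
-/
theorem card_mul_ncard_fiber {G H : Type*} [Group G] [Group H] [Finite G] (φ : G →* H)
    (hφ : Function.Surjective φ) (h : H) : Nat.card H * {u | φ u = h}.ncard = Nat.card G := by
  classical
  have := Fintype.ofFinite G
  have : Finite H := Finite.of_surjective φ hφ
  have := Fintype.ofFinite H
  have key : ∀ h' : H, (Finset.univ.filter fun u => φ u = h').card
      = (Finset.univ.filter fun u => φ u = h).card := fun h' =>
    MonoidHom.card_fiber_eq_of_mem_range φ (hφ h') (hφ h)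
  have h1 := Finset.card_eq_sum_card_fiberwise (f := φ) (s := Finset.univ) (t := Finset.univ)
    (fun _ _ => Finset.mem_coe.2 (Finset.mem_univ _))
  rw [Finset.sum_congr rfl fun h' _ => key h'] at h1
  rw [Nat.card_eq_fintype_card, Nat.card_eq_fintype_card, ← Finset.card_univ (α := G), h1,
    Set.ncard_eq_toFinset_card']
  simp

theorem isBGW_projDet {ι F G : Type*} [Fintype ι] [Field F] [Fintype F] [Group G]
    (e : ι ≃ Option F) (φ : Fˣ →* G) (hφ : Function.Surjective φ) {q : ℕ}
    (hq : Fintype.card F = q) :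
    IsBGW (q + 1) q (q - 1)
      (Matrix.of fun i j => unitHomWithZero φ (projDet (e i) (e j))) := by
  classical
  have hι : Fintype.card ι = q + 1 := by rw [Fintype.card_congr e, Fintype.card_option, hq]
  have hne : ∀ i j : ι, projDet (e i) (e j) ≠ 0 ↔ j ≠ i := fun i j => by
    rw [Ne, projDet_eq_zero, e.injective.eq_iff, eq_comm]
  refine ⟨hι, fun i => ?_, fun i i' hii g => ?_⟩
  · simp only [Matrix.of_apply, map_ne_zero, hne]
    rw [Set.ncard_eq_toFinset_card']
    simp [Finset.filter_ne', hι]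
  -- `r` is the quotient of the two rows. It is injective between sets of the same size q - 1, hence
  -- a bijection onto the units.
  · let r : {j : ι // j ≠ i ∧ j ≠ i'} → Fˣ := fun j =>
      Units.mk0 _ ((hne i j).2 j.2.1) / Units.mk0 _ ((hne i' j).2 j.2.2)
    have hr : Function.Injective r := by
      rintro ⟨j, hj⟩ ⟨k, hk⟩ hjk
      have h1 : projDet (e i) (e j) / projDet (e i') (e j)
          = projDet (e i) (e k) / projDet (e i') (e k) := by
        simpa [r] using congrArg (Units.val) hjk
      -- Equal quotients at j and k make the Plücker product det(i, i') det(j, k) vanish.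
      rw [div_eq_div_iff ((hne _ _).2 hj.2) ((hne _ _).2 hk.2), ← sub_eq_zero,
        projDet_plucker, mul_eq_zero, projDet_eq_zero, projDet_eq_zero] at h1
      rcases h1 with h1 | h1
      · exact absurd (e.injective h1) hii
      · exact Subtype.ext (e.injective h1)
    have hcard : Fintype.card {j : ι // j ≠ i ∧ j ≠ i'} = Fintype.card Fˣ := by
      have : (Finset.univ.filter fun j : ι => j ≠ i ∧ j ≠ i') = (Finset.univ.erase i).erase i' := by
        ext j; simp [and_comm]
      rw [Fintype.card_subtype, this, Finset.card_erase_of_mem (by simpa using hii.symm),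
        Finset.card_erase_of_mem (by simp), Finset.card_univ, hι, Fintype.card_units, hq]
      omega
    have hb := (Fintype.bijective_iff_injective_and_card r).2 ⟨hr, hcard⟩
    have hcoe : ∀ j, unitHomWithZero φ (projDet (e i) (e j)) *
        (unitHomWithZero φ (projDet (e i') (e j)))⁻¹
          = unitHomWithZero φ (projDet (e i) (e j) / projDet (e i') (e j)) := fun j => by
      rw [map_div₀, div_eq_mul_inv]
    have hrg : ∀ j, unitHomWithZero φ (projDet (e i) (e j.1) / projDet (e i') (e j.1))
        = (φ (r j) : WithZero G) := fun j => by
      rw [← unitHomWithZero_unit]; simp [r]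
    have hG : Nat.card G * {u | φ u = g}.ncard = q - 1 := by
      rw [card_mul_ncard_fiber φ hφ g, Nat.card_units, Nat.card_eq_fintype_card, hq]
    rw [← hG]
    congr 1
    refine Set.ncard_congr (fun j hj => r ⟨j, ?_⟩) ?_ ?_ ?_
    · simpa [hne] using And.intro hj.1 hj.2.1
    · intro j hj
      have h1 := hj.2.2
      simp only [Matrix.of_apply] at h1
      rw [hcoe] at h1
      have h2 := hrg ⟨j, by simpa [hne] using And.intro hj.1 hj.2.1⟩
      exact WithZero.coe_injective (h2.symm.trans h1)
    · intro j k hj hk hjk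
      exact congrArg Subtype.val (hr hjk)
    · intro u hu
      obtain ⟨j, rfl⟩ := hb.2 u
      refine ⟨j.1, ⟨?_, ?_, ?_⟩, rfl⟩
      · simpa using (hne _ _).2 j.2.1
      · simpa using (hne _ _).2 j.2.2
      · rw [Matrix.of_apply, Matrix.of_apply, hcoe, hrg]
        exact congrArg _ hu

/-- The unit group is cyclic of order p² - 1 = 4n(n - 1), so it reduces onto the residues mod 4n.
The element -1 sits at half the order, 2n(n - 1), which is 2n mod 4n because n - 1 is odd. -/
theorem exists_unitHom_cyc {F : Type*} [Field F] [Fintype F] {n p : ℕ} [NeZero n]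
    (hpn : p + 1 = 2 * n) (hn : Even n) (hF : Fintype.card F = p ^ 2) :
    ∃ φ : Fˣ →* Cyc n, Function.Surjective φ ∧ φ (-1) = cycNeg n := by
  obtain ⟨k, rfl⟩ := hn
  have hk : 0 < k := Nat.pos_of_ne_zero fun h => NeZero.ne (k + k) (by omega)
  have hcard : Nat.card Fˣ = 4 * (k + k) * (k + k - 1) := by
    rw [Nat.card_units, Nat.card_eq_fintype_card, hF]
    obtain ⟨l, rfl⟩ : ∃ l, k = l + 1 := ⟨k - 1, by omega⟩
    have : p = 4 * l + 3 := by omega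
    subst this
    have : l + 1 + (l + 1) - 1 = 2 * l + 1 := by omega
    rw [this]
    apply Nat.sub_eq_of_eq_add
    ring
  have hdvd : 4 * (k + k) ∣ Nat.card Fˣ := ⟨_, hcard⟩
  obtain ⟨e⟩ : Nonempty (Multiplicative (ZMod (Nat.card Fˣ)) ≃* Fˣ) :=
    ⟨zmodCyclicMulEquiv inferInstance⟩
  set c : ZMod (Nat.card Fˣ) →+ ZMod (4 * (k + k)) :=
    (ZMod.castHom hdvd (ZMod (4 * (k + k)))).toAddMonoidHom with hc
  refine ⟨(AddMonoidHom.toMultiplicative c).comp e.symm.toMonoidHom, ?_, ?_⟩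
  · exact (ZMod.castHom_surjective hdvd).comp e.symm.surjective
  · clear_value c
    generalize hN : Nat.card Fˣ = N at *
    have hNpos : 0 < N := hN ▸ Nat.card_pos
    have : NeZero N := ⟨hNpos.ne'⟩
    set x : ZMod N := Multiplicative.toAdd (e.symm (-1)) with hx
    have hx2 : x + x = 0 := by
      have : e.symm (-1) * e.symm (-1) = 1 := by rw [← map_mul]; simp
      exact this
    -- Otherwise 1 = -1, the characteristic is 2 and p² is even, whereas p = 2n - 1 is odd.
    have hx0 : x ≠ 0 := by
      intro h
      have : e.symm (-1) = 1 := h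
      rw [map_eq_one_iff _ e.symm.injective] at this
      have h2 : (2 : F) = 0 := by
        have := congrArg Units.val this
        rw [Units.val_neg, Units.val_one] at this
        linear_combination -this
      have h3 : ringChar F = 2 := by
        have h4 : ringChar F ∣ 2 := ringChar.dvd (by exact_mod_cast h2)
        exact (Nat.prime_two.eq_one_or_self_of_dvd _ h4).resolve_left CharP.ringChar_ne_one
      have h5 := FiniteField.even_card_iff_char_two.1 h3
      rw [hF] at h5
      have : p = 2 * (k + k - 1) + 1 := by omega
      rw [this] at h5
      simp [Nat.pow_mod, Nat.add_mod] at h5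
    have hv : x.val = 2 * (k + k) * (k + k - 1) := by
      have h1 : x.val < N := ZMod.val_lt x
      have h2 : x.val ≠ 0 := by rwa [Ne, ZMod.val_eq_zero]
      have h3 : (x.val + x.val) % N = 0 := by rw [← ZMod.val_add, hx2, ZMod.val_zero]
      have h4 : x.val + x.val = N := by
        obtain ⟨d, hd⟩ := Nat.dvd_of_mod_eq_zero h3
        have : d = 1 := by
          rcases d with _ | _ | d
          · omega
          · rfl
          · exfalso; nlinarith
        rw [this] at hd; omega
      have h5 : N = 2 * (2 * (k + k) * (k + k - 1)) := by rw [hcard]; ring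
      omega
    have : c x = ((2 * (k + k) : ℕ) : ZMod (4 * (k + k))) := by
      have h1 : c x = ((x.val : ℕ) : ZMod (4 * (k + k))) := by
        conv_lhs => rw [← ZMod.natCast_zmod_val x, hc]
        exact map_natCast (ZMod.castHom hdvd (ZMod (4 * (k + k)))) _
      rw [h1, hv, ZMod.natCast_eq_natCast_iff]
      obtain ⟨l, rfl⟩ : ∃ l, k = l + 1 := ⟨k - 1, by omega⟩
      have : l + 1 + (l + 1) - 1 = 2 * l + 1 := by omega
      rw [this]
      -- With n = 2(l + 1), the residue 2n(n - 1) exceeds 2n by 4n·l.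
      exact (Nat.modEq_iff_dvd.2 ⟨-l, by push_cast; ring⟩)
    exact congrArg Multiplicative.ofAdd this

theorem exists_isBGW_isSkewBGW {n p : ℕ} [NeZero n] (hpn : p + 1 = 2 * n) (hp : IsPrimePow p)
    (hn : Even n) :
    ∃ W : Matrix (Fin (p ^ 2 + 1)) (Fin (p ^ 2 + 1)) (WithZero (Cyc n)),
      IsBGW (p ^ 2 + 1) (p ^ 2) (p ^ 2 - 1) W ∧ IsSkewBGW (cycNeg n) W := by
  obtain ⟨r, m, hr, hm, rfl⟩ := (isPrimePow_nat_iff _).1 hp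
  have : Fact r.Prime := ⟨hr⟩
  have hF : Nat.card (GaloisField r (m * 2)) = (r ^ m) ^ 2 := by
    rw [GaloisField.card _ _ (by omega), pow_mul]
  have := Fintype.ofFinite (GaloisField r (m * 2))
  rw [Nat.card_eq_fintype_card] at hF
  obtain ⟨φ, hφ, hneg⟩ := exists_unitHom_cyc hpn hn hF
  have e : Fin ((r ^ m) ^ 2 + 1) ≃ Option (GaloisField r (m * 2)) :=
    Fintype.equivOfCardEq (by rw [Fintype.card_option, hF, Fintype.card_fin])
  refine ⟨_, isBGW_projDet e φ hφ hF, fun i j => ?_⟩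
  rw [Matrix.of_apply, Matrix.of_apply, projDet_swap, neg_eq_neg_one_mul, map_mul, ← hneg,
    ← unitHomWithZero_unit]
  simp

/-- The order 2n = p + 1 exceeds 2, so it is divisible by 4. -/
theorem even_of_isHadamard {n p : ℕ} (hpn : p + 1 = 2 * n) (hp : IsPrimePow p)
    {K : Matrix (Fin (2 * n)) (Fin (2 * n)) ℤ} (hK : K.IsHadamard) : Even n := by
  have := hp.two_le
  have h := hK.four_dvd_card (by rw [Fintype.card_fin]; omega)
  rw [Fintype.card_fin] at h
  exact even_iff_two_dvd.2 (by omega)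

end Existence

/-! ### The cyclic group of order 4n acting through powers of a ring element. -/

section Power

/-- Sends the residue `a` to `X ^ a` and zero to zero. -/
noncomputable def cycPow {n : ℕ} {A : Type*} [Ring A] (X : A) : WithZero (Cyc n) → A :=
  WithZero.recZeroCoe 0 (fun a => X ^ (Multiplicative.toAdd a).val)

variable {n : ℕ} {A : Type*} [Ring A] {X R : A}

@[simp] theorem cycPow_zero : cycPow X (0 : WithZero (Cyc n)) = 0 := rfl

theorem cycPow_coe (a : Cyc n) : cycPow X (a : WithZero (Cyc n)) = X ^ (Multiplicative.toAdd a).val :=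
  rfl

/-- The factor 1 + X^(2n) is 0 for the negacyclic shift and 2 for the cyclic shift. -/
theorem sum_range_four_mul (X : A) : ∑ k ∈ Finset.range (4 * n), X ^ k
    = (1 + X ^ (2 * n)) * ∑ k ∈ Finset.range (2 * n), X ^ k := by
  rw [show 4 * n = 2 * n + 2 * n by ring, Finset.sum_range_add, add_mul, one_mul, Finset.mul_sum]
  simp only [pow_add]

@[simp] theorem cycPow_one : cycPow X (1 : WithZero (Cyc n)) = 1 := by
  rw [← WithZero.coe_one, cycPow_coe]; simp

variable [NeZero n]

theorem cycPow_mul (hX : X ^ (4 * n) = 1) (a b : WithZero (Cyc n)) :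
    cycPow X (a * b) = cycPow X a * cycPow X b := by
  induction a with
  | zero => simp
  | coe a =>
    induction b with
    | zero => simp
    | coe b =>
      rw [← WithZero.coe_mul, cycPow_coe, cycPow_coe, cycPow_coe, ← pow_add, toAdd_mul,
        ZMod.val_add, ← pow_eq_pow_mod _ hX]

theorem cycPow_cycNeg : cycPow X (cycNeg n : WithZero (Cyc n)) = X ^ (2 * n) := by
  have := NeZero.pos n
  rw [cycPow_coe, cycNeg, toAdd_ofAdd, ZMod.val_natCast, Nat.mod_eq_of_lt (by omega)]

/-- The relation X R X = R says that moving R past X inverts X. The zero element causes no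
exception, since its inverse is zero. -/
theorem mul_cycPow_eq_cycPow_inv_mul (hX : X ^ (4 * n) = 1) (hR : X * R * X = R)
    (a : WithZero (Cyc n)) : R * cycPow X a = cycPow X a⁻¹ * R := by
  induction a with
  | zero => simp
  | coe a =>
    have h : ∀ k : ℕ, X ^ k * R * X ^ k = R := fun k => by
      induction k with
      | zero => simp
      | succ k ih =>
        calc X ^ (k + 1) * R * X ^ (k + 1) = X * (X ^ k * R * X ^ k) * X := by
              nth_rw 1 [pow_succ' X k]
              rw [pow_succ X k]; simp only [mul_assoc]
          _ = R := by rw [ih, hR]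
    have h1 : cycPow X (a : WithZero (Cyc n))⁻¹ * cycPow X (a : WithZero (Cyc n)) = 1 := by
      rw [← cycPow_mul hX, inv_mul_cancel₀ WithZero.coe_ne_zero, cycPow_one]
    calc R * cycPow X (a : WithZero (Cyc n))
        = (cycPow X (a : WithZero (Cyc n))⁻¹ * cycPow X (a : WithZero (Cyc n))) *
          (R * cycPow X (a : WithZero (Cyc n))) := by rw [h1, one_mul]
      _ = cycPow X (a : WithZero (Cyc n))⁻¹ *
          (cycPow X (a : WithZero (Cyc n)) * R * cycPow X (a : WithZero (Cyc n))) := by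
        simp only [mul_assoc]
      _ = _ := by rw [cycPow_coe (X := X) a, h]

/-- The reflection R produces the quotient a b⁻¹ of the BGW condition without any transpose. -/
theorem cycPow_mul_refl_mul_cycPow_mul_refl (hX : X ^ (4 * n) = 1) (hR : X * R * X = R)
    (hRR : R * R = 1) (a b : WithZero (Cyc n)) :
    cycPow X a * R * (cycPow X b * R) = cycPow X (a * b⁻¹) := by
  rw [← mul_assoc, mul_assoc (cycPow X a), mul_cycPow_eq_cycPow_inv_mul hX hR, cycPow_mul hX]
  simp only [mul_assoc, hRR, mul_one]

theorem sum_cycPow : ∑ g : Cyc n, cycPow X (g : WithZero (Cyc n)) = ∑ k ∈ Finset.range (4 * n), X ^ k := by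
  simp only [cycPow_coe]
  refine Finset.sum_bij' (fun g _ => (Multiplicative.toAdd g).val)
    (fun k _ => Multiplicative.ofAdd (k : ZMod (4 * n))) ?_ ?_ ?_ ?_ ?_
  · intro g _; exact Finset.mem_range.2 (ZMod.val_lt _)
  · simp
  · intro g _; exact ZMod.natCast_zmod_val (Multiplicative.toAdd g)
  · intro k hk
    rw [toAdd_ofAdd, ZMod.val_natCast, Nat.mod_eq_of_lt (Finset.mem_range.1 hk)]
  · simp

end Power

/-! ### Sums over the quotients of two rows of a BGW. -/

section BGWSum

variable {ι G A : Type*} [Fintype ι] [Group G] [AddCommGroup A] {v k l : ℕ}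
  {W : Matrix ι ι (WithZero G)}

theorem IsBGW.sum_self (hW : IsBGW v k l W) {f : WithZero G → A} (hf : f 0 = 0) (i : ι) :
    ∑ j, f (W i j * (W i j)⁻¹) = k • f 1 := by
  classical
  have h : ∀ j, f (W i j * (W i j)⁻¹) = if W i j ≠ 0 then f 1 else 0 := fun j => by
    split_ifs with h
    · rw [mul_inv_cancel₀ h]
    · rw [not_not.1 h, zero_mul, hf]
  rw [Finset.sum_congr rfl fun j _ => h j, ← Finset.sum_filter, Finset.sum_const, ← hW.weight i,
    Set.ncard_eq_toFinset_card']
  simp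

/-- Each group element occurs l / |G| times among the quotients. Multiplying by |G| avoids this
division, and f 0 = 0 discards the columns with a zero entry. -/
theorem IsBGW.sum_ne [Fintype G] (hW : IsBGW v k l W) {f : WithZero G → A} (hf : f 0 = 0) {i i' : ι}
    (hi : i ≠ i') :
    Nat.card G • ∑ j, f (W i j * (W i' j)⁻¹) = l • ∑ g : G, f g := by
  classical
  have h : ∀ j, f (W i j * (W i' j)⁻¹)
      = ∑ g : G, if W i j ≠ 0 ∧ W i' j ≠ 0 ∧ W i j * (W i' j)⁻¹ = (g : WithZero G) then f g else 0 :=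
      fun j => by
    by_cases h0 : W i j * (W i' j)⁻¹ = 0
    · rw [h0, hf, Finset.sum_eq_zero]
      rintro g -
      rw [if_neg]
      rintro ⟨-, -, h⟩
      exact WithZero.coe_ne_zero h.symm
    · obtain ⟨h1, h2⟩ := mul_ne_zero_iff.1 h0
      obtain ⟨c, hc⟩ := WithZero.ne_zero_iff_exists.1 h0
      have h2 : W i' j ≠ 0 := fun h => h2 (by rw [h, inv_zero])
      simp [h1, h2, ← hc]
  rw [Finset.sum_congr rfl fun j _ => h j, Finset.sum_comm, Finset.smul_sum, Finset.smul_sum]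
  refine Finset.sum_congr rfl fun g _ => ?_
  rw [← Finset.sum_filter, Finset.sum_const, smul_smul, ← hW.balanced i i' hi g,
    Set.ncard_eq_toFinset_card']
  simp

end BGWSum

/-! ### Signed cyclic shifts and the back identity. -/

section Shift

/-- The back identity matrix of order `m`. -/
def backId (m : ℕ) : Matrix (Fin m) (Fin m) ℤ :=
  Matrix.of fun i j => if j = i.rev then (1 : ℤ) else 0

theorem backId_mul_apply {m : ℕ} (M : Matrix (Fin m) (Fin m) ℤ) (i j : Fin m) :
    (backId m * M) i j = M i.rev j := by
  simp [backId, Matrix.mul_apply]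

theorem mul_backId_apply {m : ℕ} (M : Matrix (Fin m) (Fin m) ℤ) (i j : Fin m) :
    (M * backId m) i j = M i j.rev := by
  simp [backId, Matrix.mul_apply, ← Fin.rev_eq_iff]

theorem backId_mul_self (m : ℕ) : backId m * backId m = 1 := by
  ext i j
  rw [backId_mul_apply]
  simp [backId, Matrix.one_apply, eq_comm]

variable {m : ℕ} [NeZero m]

/-- The cyclic shift of order `m` with row `i` multiplied by `s i`. -/
def signedShift (s : Fin m → ℤ) : Matrix (Fin m) (Fin m) ℤ :=
  Matrix.of fun i j => if j = i + 1 then s i else 0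

theorem signedShift_mul_apply (s : Fin m → ℤ) (M : Matrix (Fin m) (Fin m) ℤ) (i j : Fin m) :
    (signedShift s * M) i j = s i * M (i + 1) j := by
  simp [signedShift, Matrix.mul_apply]

theorem Fin.rev_add_one_add_one (i : Fin m) : (i + 1).rev + 1 = i.rev := by
  cases m with
  | zero => exact i.elim0
  | succ m => rw [← Fin.last_sub, ← Fin.last_sub]; abel

theorem signedShift_mul_backId_mul_signedShift {s : Fin m → ℤ}
    (hs : ∀ i, s i * s (i + 1).rev = 1) :
    signedShift s * backId m * signedShift s = backId m := by
  ext i j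
  rw [Matrix.mul_assoc, signedShift_mul_apply, backId_mul_apply]
  simp only [signedShift, backId, Matrix.of_apply, mul_ite, mul_zero, Fin.rev_add_one_add_one, hs]

/-- Only the position of the single nonzero entry of a row matters for the zero pattern, so its sign
`e` is left unspecified. -/
theorem signedShift_pow_apply {s : Fin m → ℤ} (hs : ∀ i, s i = 1 ∨ s i = -1) (k : ℕ)
    (i : Fin m) : ∃ e : ℤ, (e = 1 ∨ e = -1) ∧
      ∀ j, (signedShift s ^ k) i j = if j = i + k • (1 : Fin m) then e else 0 := by
  induction k generalizing i with
  | zero => exact ⟨1, Or.inl rfl, fun j => by simp [Matrix.one_apply, eq_comm]⟩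
  | succ k ih =>
    obtain ⟨e, he, h⟩ := ih (i + 1)
    refine ⟨s i * e, ?_, fun j => ?_⟩
    · rcases hs i with h | h <;> rcases he with h' | h' <;> simp [h, h']
    · rw [pow_succ', signedShift_mul_apply, h, succ_nsmul', ← add_assoc]
      simp

theorem signedShift_one_pow_apply (k : ℕ) (i j : Fin m) :
    (signedShift (1 : Fin m → ℤ) ^ k) i j = if j = i + k • (1 : Fin m) then 1 else 0 := by
  induction k generalizing i with
  | zero => simp [Matrix.one_apply, eq_comm]
  | succ k ih =>
    rw [pow_succ', signedShift_mul_apply, ih, succ_nsmul', ← add_assoc, Pi.one_apply, one_mul]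

theorem Fin.val_nsmul_one (j : Fin m) : (j : ℕ) • (1 : Fin m) = j := by
  have h : ∀ k : ℕ, ((k • (1 : Fin m) : Fin m) : ℕ) = k % m := fun k => by
    induction k with
    | zero => simp
    | succ k ih => rw [succ_nsmul, Fin.val_add, ih, Fin.val_one', ← Nat.add_mod]
  exact Fin.ext (by rw [h, Nat.mod_eq_of_lt j.2])

theorem signedShift_one_pow_card : signedShift (1 : Fin m → ℤ) ^ m = 1 := by
  ext i j
  have : m • (1 : Fin m) = 0 := by simpa using card_nsmul_eq_zero (x := (1 : Fin m))
  rw [signedShift_one_pow_apply, this, add_zero, Matrix.one_apply]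
  simp [eq_comm]

theorem sum_signedShift_one_pow :
    ∑ k ∈ Finset.range m, signedShift (1 : Fin m → ℤ) ^ k = allOnes (Fin m) := by
  ext i j
  rw [Finset.sum_range, Matrix.sum_apply]
  simp only [signedShift_one_pow_apply, Fin.val_nsmul_one, allOnes, Matrix.of_apply]
  simp [← sub_eq_iff_eq_add']

end Shift

/-! ### The negacyclic and the cyclic shift of order 2n. -/

section NegaShift

variable {n : ℕ} [NeZero n]

theorem negaShift_eq_signedShift :
    negaShift n = signedShift fun i => if (i : ℕ) + 1 = 2 * n then -1 else 1 := by
  ext i j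
  have := NeZero.pos n
  have h1 : ((1 : Fin (2 * n)) : ℕ) = 1 := by
    rw [Fin.val_one', Nat.mod_eq_of_lt (by omega)]
  simp only [negaShift, signedShift, Matrix.of_apply, Fin.ext_iff, Fin.val_add, h1]
  have := i.2
  have := j.2
  by_cases h : (i : ℕ) + 1 = 2 * n
  · rw [h, Nat.mod_self]; split_ifs <;> first | rfl | omega
  · rw [Nat.mod_eq_of_lt (by omega)]; split_ifs <;> first | rfl | omega

/-- With k ≤ 2n a row wraps around at most once, so at most one sign appears. -/
theorem negaShift_pow_apply {k : ℕ} (hk : k ≤ 2 * n) (i j : Fin (2 * n)) :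
    (negaShift n ^ k) i j =
      if (i : ℕ) + k = j then 1 else if (i : ℕ) + k = j + 2 * n then -1 else 0 := by
  induction k generalizing i with
  | zero =>
    have := j.2
    have := i.2
    simp only [pow_zero, Matrix.one_apply, Fin.ext_iff]
    split_ifs <;> first | rfl | omega
  | succ k ih =>
    have := NeZero.pos n
    have h1 : ((1 : Fin (2 * n)) : ℕ) = 1 := by
      rw [Fin.val_one', Nat.mod_eq_of_lt (by omega)]
    rw [pow_succ']
    nth_rw 1 [negaShift_eq_signedShift]
    rw [signedShift_mul_apply, ih (by omega), Fin.val_add, h1]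
    have := i.2
    have := j.2
    by_cases h : (i : ℕ) + 1 = 2 * n
    · rw [h, Nat.mod_self]; split_ifs <;> first | rfl | omega
    · rw [Nat.mod_eq_of_lt (by omega)]; split_ifs <;> first | rfl | omega

theorem negaShift_pow_two_mul : negaShift n ^ (2 * n) = -1 := by
  ext i j
  rw [negaShift_pow_apply le_rfl, Matrix.neg_apply, Matrix.one_apply]
  have := i.2
  have := j.2
  simp only [Fin.ext_iff]
  split_ifs <;> first | rfl | omega

theorem negaShift_pow_four_mul : negaShift n ^ (4 * n) = 1 := by
  rw [show 4 * n = 2 * n * 2 by ring, pow_mul, negaShift_pow_two_mul, neg_one_sq]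

theorem cyclicShift_pow_four_mul : signedShift (1 : Fin (2 * n) → ℤ) ^ (4 * n) = 1 := by
  rw [show 4 * n = 2 * n * 2 by ring, pow_mul, signedShift_one_pow_card, one_pow]

/-- The only negative row is the last one, which i ↦ rev (i + 1) fixes, so the two signs cancel. -/
theorem negaShift_mul_backId_mul_negaShift :
    negaShift n * backId (2 * n) * negaShift n = backId (2 * n) := by
  rw [negaShift_eq_signedShift]
  refine signedShift_mul_backId_mul_signedShift fun i => ?_
  have := NeZero.pos n
  have h1 : ((1 : Fin (2 * n)) : ℕ) = 1 := by
    rw [Fin.val_one', Nat.mod_eq_of_lt (by omega)]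
  have := i.2
  simp only [Fin.val_rev, Fin.val_add, h1]
  by_cases h : (i : ℕ) + 1 = 2 * n
  · rw [h, Nat.mod_self]; split_ifs <;> first | rfl | omega
  · rw [Nat.mod_eq_of_lt (by omega)]; split_ifs <;> first | rfl | omega

theorem cyclicShift_mul_backId_mul_cyclicShift :
    signedShift (1 : Fin (2 * n) → ℤ) * backId (2 * n) * signedShift 1 = backId (2 * n) :=
  signedShift_mul_backId_mul_signedShift fun _ => rfl

theorem sum_cycPow_negaShift :
    ∑ g : Cyc n, cycPow (negaShift n) (g : WithZero (Cyc n)) = 0 := by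
  rw [sum_cycPow, sum_range_four_mul, negaShift_pow_two_mul]; simp

theorem sum_cycPow_cyclicShift :
    ∑ g : Cyc n, cycPow (signedShift (1 : Fin (2 * n) → ℤ)) (g : WithZero (Cyc n))
      = 2 • allOnes (Fin (2 * n)) := by
  rw [sum_cycPow, sum_range_four_mul, signedShift_one_pow_card, sum_signedShift_one_pow, add_mul,
    one_mul, two_nsmul]

end NegaShift

/-! ### The rank-one matrices of a normalized Hadamard matrix. -/

section Hadamard

theorem allOnes_apply {X : Type*} (x y : X) : allOnes X x y = 1 := rfl

theorem allOnes_mul_self (X : Type*) [Fintype X] :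
    allOnes X * allOnes X = (Fintype.card X : ℤ) • allOnes X := by
  ext x y; simp [Matrix.mul_apply, allOnes_apply]

theorem allOnes_prod (X Y : Type*) : allOnes (X × Y) = allOnes X ⊗ₖ allOnes Y := by
  ext x y; simp [allOnes_apply]

theorem allOnes_transpose (X : Type*) : (allOnes X)ᵀ = allOnes X := rfl

theorem Matrix.IsHadamard.sq_apply {m : ℕ} {K : Matrix (Fin m) (Fin m) ℤ} (hK : K.IsHadamard)
    (i j : Fin m) : K i j * K i j = 1 := by
  simpa using (Unitary.mem_iff.1 (hK.apply_mem i j)).1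

variable {n : ℕ} [NeZero n] {K : Matrix (Fin (2 * n)) (Fin (2 * n)) ℤ}

theorem normalizeHadamard_mul_transpose (hK : K.IsHadamard) :
    normalizeHadamard K * (normalizeHadamard K)ᵀ = (2 * n : ℤ) • 1 := by
  have h := hK.mul_conjTranspose
  rw [Matrix.conjTranspose_eq_transpose_of_trivial] at h
  ext i j
  have h' := congrFun (congrFun h i) j
  simp only [Matrix.mul_apply, normalizeHadamard, Matrix.of_apply, Matrix.transpose_apply,
    Fintype.card_fin] at h' ⊢
  push_cast at h'
  rw [← h']
  refine Finset.sum_congr rfl fun k _ => ?_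
  linear_combination K i k * K j k * hK.sq_apply 0 k

theorem normalizeHadamard_transpose_mul (hK : K.IsHadamard) :
    (normalizeHadamard K)ᵀ * normalizeHadamard K = (2 * n : ℤ) • 1 := by
  have h := hK.conjTranspose_mul
  rw [Matrix.conjTranspose_eq_transpose_of_trivial] at h
  ext i j
  have h' := congrFun (congrFun h i) j
  simp only [Matrix.mul_apply, normalizeHadamard, Matrix.of_apply, Matrix.transpose_apply,
    Fintype.card_fin] at h' ⊢
  push_cast at h'
  have : ∑ k, K k i * K 0 i * (K k j * K 0 j) = (K 0 i * K 0 j) * ∑ k, K k i * K k j := by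
    rw [Finset.mul_sum]
    exact Finset.sum_congr rfl fun k _ => by ring
  rw [this, h']
  rcases eq_or_ne i j with rfl | hij
  · rw [hK.sq_apply, one_mul]
  · simp [hij]

theorem normalizeHadamard_zero (hK : K.IsHadamard) (j : Fin (2 * n)) :
    normalizeHadamard K 0 j = 1 := hK.sq_apply 0 j

theorem normalizeHadamard_sq (hK : K.IsHadamard) (i j : Fin (2 * n)) :
    normalizeHadamard K i j = 1 ∨ normalizeHadamard K i j = -1 := by
  rw [← mul_self_eq_one_iff, normalizeHadamard, Matrix.of_apply]
  linear_combination K 0 j * K 0 j * hK.sq_apply i j + hK.sq_apply 0 j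

theorem hadamardC_apply (k i j : Fin (2 * n)) :
    hadamardC K k i j = normalizeHadamard K k i * normalizeHadamard K k j := rfl

theorem hadamardC_sq (hK : K.IsHadamard) (k i j : Fin (2 * n)) :
    hadamardC K k i j = 1 ∨ hadamardC K k i j = -1 := by
  rw [hadamardC_apply]
  rcases normalizeHadamard_sq hK k i with h | h <;>
    rcases normalizeHadamard_sq hK k j with h' | h' <;> simp [h, h']

theorem hadamardC_transpose (k : Fin (2 * n)) : (hadamardC K k)ᵀ = hadamardC K k := by
  ext i j
  rw [Matrix.transpose_apply, hadamardC_apply, hadamardC_apply, mul_comm]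

theorem hadamardC_zero (hK : K.IsHadamard) : hadamardC K 0 = allOnes _ := by
  ext i j
  rw [hadamardC_apply, normalizeHadamard_zero hK, normalizeHadamard_zero hK]; rfl

/-- The product contains the scalar h_k h_lᵀ in the middle, which is 2n or 0 by orthogonality of the
rows. -/
theorem hadamardC_mul (hK : K.IsHadamard) (k l : Fin (2 * n)) :
    hadamardC K k * hadamardC K l = if k = l then (2 * n : ℤ) • hadamardC K k else 0 := by
  have h := congrFun (congrFun (normalizeHadamard_mul_transpose hK) k) l
  simp only [Matrix.mul_apply, Matrix.transpose_apply, Matrix.smul_apply, Matrix.one_apply] at h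
  ext i j
  have : ∑ x, normalizeHadamard K k i * normalizeHadamard K k x *
      (normalizeHadamard K l x * normalizeHadamard K l j) =
      normalizeHadamard K k i * normalizeHadamard K l j *
        ∑ x, normalizeHadamard K k x * normalizeHadamard K l x := by
    rw [Finset.mul_sum]
    exact Finset.sum_congr rfl fun k _ => by ring
  simp only [Matrix.mul_apply, hadamardC_apply]
  rw [this, h]
  split_ifs with hkl
  · subst hkl
    simp only [Matrix.smul_apply, hadamardC_apply, smul_eq_mul]; ring
  · simp

/-- The sum over all k is the Gram matrix of the columns, 2n times the identity; the omitted term is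
all-ones. -/
theorem sum_hadamardC (hK : K.IsHadamard) :
    ∑ k ∈ Finset.univ.erase 0, hadamardC K k = (2 * n : ℤ) • 1 - allOnes (Fin (2 * n)) := by
  rw [eq_sub_iff_add_eq, ← hadamardC_zero hK, Finset.sum_erase_add _ _ (Finset.mem_univ _),
    ← normalizeHadamard_transpose_mul hK]
  ext i j
  simp [Matrix.sum_apply, Matrix.mul_apply, hadamardC_apply]

end Hadamard

/-! ### The blocks H w R and their zero patterns. -/

section Blocks

variable {n : ℕ}

theorem cycMatrix_eq (w : WithZero (Cyc n)) :
    cycMatrix n w = cycPow (negaShift n) w ⊗ₖ (1 : Matrix (Fin (2 * n)) (Fin (2 * n)) ℤ) := by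
  induction w with
  | zero => exact (Matrix.zero_kronecker _).symm
  | coe a =>
    have h : ∀ k : ℕ, blockShift n ^ k
        = (negaShift n ^ k) ⊗ₖ (1 : Matrix (Fin (2 * n)) (Fin (2 * n)) ℤ) := fun k => by
      induction k with
      | zero => simp
      | succ k ih =>
        rw [pow_succ, ih, blockShift, ← Matrix.mul_kronecker_mul, one_mul, pow_succ]
    exact h _

variable [NeZero n]

/-- A block `H w R` of the twin matrix. -/
noncomputable def twinBlock (K : Matrix (Fin (2 * n)) (Fin (2 * n)) ℤ) (w : WithZero (Cyc n)) :
    Matrix (Fin (2 * n) × Fin (2 * n)) (Fin (2 * n) × Fin (2 * n)) ℤ :=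
  ∑ k ∈ Finset.univ.erase (0 : Fin (2 * n)),
    (negaShift n ^ (k : ℕ) * (cycPow (negaShift n) w * backId (2 * n))) ⊗ₖ hadamardC K k

/-- The zero pattern of a block `H w R` with `w ≠ 0`, and zero for `w = 0`. -/
noncomputable def zeroBlock (w : WithZero (Cyc n)) :
    Matrix (Fin (2 * n) × Fin (2 * n)) (Fin (2 * n) × Fin (2 * n)) ℤ :=
  (cycPow (signedShift 1) w * backId (2 * n)) ⊗ₖ allOnes (Fin (2 * n))

theorem twinBlock_eq (K : Matrix (Fin (2 * n)) (Fin (2 * n)) ℤ) (w : WithZero (Cyc n)) :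
    blockNegacirculant K * cycMatrix n w * backIdentity n = twinBlock K w := by
  rw [cycMatrix_eq, blockNegacirculant, backIdentity, Matrix.mul_assoc,
    ← Matrix.mul_kronecker_mul, one_mul, Finset.sum_mul, twinBlock]
  refine Finset.sum_congr rfl fun k _ => ?_
  rw [← Matrix.mul_kronecker_mul, mul_one]
  rfl

@[simp] theorem twinBlock_zero (K : Matrix (Fin (2 * n)) (Fin (2 * n)) ℤ) :
    twinBlock K 0 = 0 := by
  simp [twinBlock]

@[simp] theorem zeroBlock_zero : zeroBlock (n := n) 0 = 0 := by
  simp [zeroBlock]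

variable {K : Matrix (Fin (2 * n)) (Fin (2 * n)) ℤ}

theorem negaShift_pow_mul_mul_backId (k : ℕ) (w : WithZero (Cyc n)) :
    negaShift n ^ k * (cycPow (negaShift n) w * backId (2 * n)) * negaShift n ^ k
      = cycPow (negaShift n) w * backId (2 * n) := by
  have h : ∀ k : ℕ, negaShift n ^ k * backId (2 * n) * negaShift n ^ k = backId (2 * n) :=
      fun k => by
    induction k with
    | zero => simp
    | succ k ih =>
      calc negaShift n ^ (k + 1) * backId (2 * n) * negaShift n ^ (k + 1)
          = negaShift n * (negaShift n ^ k * backId (2 * n) * negaShift n ^ k) * negaShift n := by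
            nth_rw 1 [pow_succ' (negaShift n) k]
            rw [pow_succ (negaShift n) k]; simp only [mul_assoc]
        _ = backId (2 * n) := by rw [ih, negaShift_mul_backId_mul_negaShift]
  have hc : Commute (negaShift n ^ k) (cycPow (negaShift n) w) := by
    induction w with
    | zero => simp
    | coe a => rw [cycPow_coe]; exact (Commute.refl _).pow_pow _ _
  rw [← mul_assoc, hc.eq, mul_assoc, mul_assoc, ← mul_assoc (negaShift n ^ k), h]

/-- Orthogonality of the `hadamardC K k` leaves only equal indices, and there the two powers N^k
cancel around the reflection wR. -/
theorem twinBlock_mul_twinBlock (hK : K.IsHadamard) (a b : WithZero (Cyc n)) :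
    twinBlock K a * twinBlock K b = cycPow (negaShift n) (a * b⁻¹) ⊗ₖ
      ((2 * n : ℤ) • ((2 * n : ℤ) • 1 - allOnes (Fin (2 * n)))) := by
  rw [← sum_hadamardC hK, twinBlock, twinBlock, Finset.sum_mul_sum, Finset.smul_sum]
  have : ∀ s : Finset (Fin (2 * n)), ∀ f : Fin (2 * n) → Matrix (Fin (2 * n)) (Fin (2 * n)) ℤ,
      ∀ M : Matrix (Fin (2 * n)) (Fin (2 * n)) ℤ, M ⊗ₖ (∑ k ∈ s, f k) = ∑ k ∈ s, M ⊗ₖ f k :=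
    fun s f M => map_sum (AddMonoidHom.mk' (fun x => M ⊗ₖ x) (Matrix.kronecker_add M)) f s
  rw [this]
  refine Finset.sum_congr rfl fun k hk => ?_
  simp only [← Matrix.mul_kronecker_mul, hadamardC_mul hK]
  rw [Finset.sum_eq_single_of_mem k hk]
  · rw [if_pos rfl, ← mul_assoc, negaShift_pow_mul_mul_backId,
      cycPow_mul_refl_mul_cycPow_mul_refl negaShift_pow_four_mul
        negaShift_mul_backId_mul_negaShift (backId_mul_self _)]
  · intro l _ hl
    rw [if_neg hl.symm, Matrix.kronecker_zero]

/-- The all-ones matrix is `hadamardC K 0`, orthogonal to every term of the block since the index 0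
is omitted. All vanishing products with T come from here. -/
theorem twinBlock_mul_kronecker_allOnes (hK : K.IsHadamard) (a : WithZero (Cyc n))
    (M : Matrix (Fin (2 * n)) (Fin (2 * n)) ℤ) :
    twinBlock K a * (M ⊗ₖ allOnes (Fin (2 * n))) = 0 := by
  rw [twinBlock, Finset.sum_mul]
  refine Finset.sum_eq_zero fun k hk => ?_
  rw [← Matrix.mul_kronecker_mul, ← hadamardC_zero hK, hadamardC_mul hK,
    if_neg (Finset.ne_of_mem_erase hk), Matrix.kronecker_zero]

theorem zeroBlock_mul_zeroBlock (a b : WithZero (Cyc n)) :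
    zeroBlock a * zeroBlock b = cycPow (signedShift 1) (a * b⁻¹) ⊗ₖ
      ((2 * n : ℤ) • allOnes (Fin (2 * n))) := by
  rw [zeroBlock, zeroBlock, ← Matrix.mul_kronecker_mul, allOnes_mul_self,
    cycPow_mul_refl_mul_cycPow_mul_refl cyclicShift_pow_four_mul
      cyclicShift_mul_backId_mul_cyclicShift (backId_mul_self _), Fintype.card_fin]
  push_cast
  rfl

theorem twinBlock_neg (w : WithZero (Cyc n)) : twinBlock K ((cycNeg n : WithZero (Cyc n)) * w) = -twinBlock K w := by
  simp only [twinBlock, cycPow_mul negaShift_pow_four_mul, cycPow_cycNeg, negaShift_pow_two_mul]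
  rw [← Finset.sum_neg_distrib]
  refine Finset.sum_congr rfl fun k _ => ?_
  ext x y
  simp

theorem zeroBlock_neg (w : WithZero (Cyc n)) : zeroBlock ((cycNeg n : WithZero (Cyc n)) * w) = zeroBlock w := by
  rw [zeroBlock, zeroBlock, cycPow_mul cyclicShift_pow_four_mul, cycPow_cycNeg,
    signedShift_one_pow_card, one_mul]

theorem zeroBlock_coe_apply (a : Cyc n) (x y : Fin (2 * n) × Fin (2 * n)) :
    zeroBlock (a : WithZero (Cyc n)) x y =
      if y.1.rev = x.1 + (Multiplicative.toAdd a).val • (1 : Fin (2 * n)) then 1 else 0 := by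
  rw [zeroBlock, Matrix.kroneckerMap_apply, mul_backId_apply, cycPow_coe,
    signedShift_one_pow_apply, allOnes_apply, mul_one]

/-- At a given position exactly one of the monomial matrices N^k w R, over all k, is nonzero. If
that k is 0 the term is absent from H and the entry is 0; otherwise a single ±1 survives. -/
theorem twinBlock_coe_apply (hK : K.IsHadamard) (a : Cyc n) (x y : Fin (2 * n) × Fin (2 * n)) :
    if y.1.rev = x.1 + (Multiplicative.toAdd a).val • (1 : Fin (2 * n))
      then twinBlock K (a : WithZero (Cyc n)) x y = 0
      else twinBlock K (a : WithZero (Cyc n)) x y = 1 ∨ twinBlock K (a : WithZero (Cyc n)) x y = -1 := by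
  have hs : ∀ i : Fin (2 * n), (if (i : ℕ) + 1 = 2 * n then (-1 : ℤ) else 1) = 1 ∨
      (if (i : ℕ) + 1 = 2 * n then (-1 : ℤ) else 1) = -1 := fun i => by split_ifs <;> simp
  have h : ∀ k : Fin (2 * n), ∃ e : ℤ, (e = 1 ∨ e = -1) ∧
      ((negaShift n ^ (k : ℕ) * (cycPow (negaShift n) (a : WithZero (Cyc n)) * backId (2 * n)))
        ⊗ₖ hadamardC K k) x y = if k = y.1.rev - (x.1 + (Multiplicative.toAdd a).val • 1)
          then e else 0 := fun k => by
    obtain ⟨e, he, h⟩ := signedShift_pow_apply hs (k + (Multiplicative.toAdd a).val) x.1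
    refine ⟨e * hadamardC K k x.2 y.2, ?_, ?_⟩
    · rcases he with h | h <;> rcases hadamardC_sq hK k x.2 y.2 with h' | h' <;> simp [h, h']
    · rw [Matrix.kroneckerMap_apply, ← mul_assoc, mul_backId_apply, cycPow_coe, ← pow_add,
        negaShift_eq_signedShift, h, ite_mul, zero_mul, add_nsmul, Fin.val_nsmul_one]
      refine if_congr ?_ rfl rfl
      rw [eq_sub_iff_add_eq, eq_comm, ← add_assoc, ← add_assoc, add_comm k]
  choose e he h using h
  have hT : twinBlock K (a : WithZero (Cyc n)) x y
      = if y.1.rev = x.1 + (Multiplicative.toAdd a).val • (1 : Fin (2 * n)) then 0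
        else e (y.1.rev - (x.1 + (Multiplicative.toAdd a).val • 1)) := by
    rw [twinBlock, Matrix.sum_apply, Finset.sum_congr rfl fun k _ => h k]
    simp [sub_eq_zero]
  rw [hT]
  split_ifs
  · rfl
  · exact he _

theorem signedShift_mul_transpose {m : ℕ} [NeZero m] {s : Fin m → ℤ} (hs : ∀ i, s i * s i = 1) :
    signedShift s * (signedShift s)ᵀ = 1 := by
  ext i j
  rw [signedShift_mul_apply, Matrix.transpose_apply, signedShift, Matrix.of_apply,
    Matrix.one_apply]
  by_cases h : i = j
  · simp [h, hs]
  · simp [h]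

/-- For orthogonal X, the relation X R X = R becomes R Xᵀ = X R. Hence all blocks are symmetric, and
the transpose of the whole matrix only exchanges the indices of W. -/
theorem transpose_pow_mul_backId {m : ℕ} {X : Matrix (Fin m) (Fin m) ℤ}
    (hX : X * Xᵀ = 1) (hR : X * backId m * X = backId m) (k : ℕ) :
    (X ^ k * backId m)ᵀ = X ^ k * backId m := by
  induction k with
  | zero =>
    ext i j
    simp only [pow_zero, one_mul, Matrix.transpose_apply, backId, Matrix.of_apply]
    refine if_congr ?_ rfl rfl
    rw [← Fin.rev_eq_iff, eq_comm]
  | succ k ih =>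
    have h : backId m * Xᵀ = X * backId m := by
      nth_rw 1 [← hR]
      rw [mul_assoc, hX, mul_one]
    rw [pow_succ', mul_assoc, Matrix.transpose_mul, ih, mul_assoc, h, ← mul_assoc, ← mul_assoc,
      ← pow_succ, ← pow_succ']

theorem zeroBlock_transpose (w : WithZero (Cyc n)) : (zeroBlock w)ᵀ = zeroBlock w := by
  induction w with
  | zero => simp
  | coe a =>
    rw [zeroBlock, cycPow_coe, ← Matrix.kroneckerMap_transpose, allOnes_transpose,
      transpose_pow_mul_backId (signedShift_mul_transpose fun _ => rfl)
        cyclicShift_mul_backId_mul_cyclicShift]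

theorem twinBlock_transpose (w : WithZero (Cyc n)) : (twinBlock K w)ᵀ = twinBlock K w := by
  induction w with
  | zero => simp
  | coe a =>
    have h : negaShift n * (negaShift n)ᵀ = 1 := by
      rw [negaShift_eq_signedShift]
      exact signedShift_mul_transpose fun i => by split_ifs <;> rfl
    rw [twinBlock, Matrix.transpose_sum]
    refine Finset.sum_congr rfl fun k _ => ?_
    rw [cycPow_coe, ← mul_assoc, ← pow_add, ← Matrix.kroneckerMap_transpose, hadamardC_transpose,
      transpose_pow_mul_backId h negaShift_mul_backId_mul_negaShift]

end Blocks

/-! ### Block matrix calculus. -/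

section BlockMatrices

variable {ι κ : Type*}

/-- The matrix with blocks `f i j`. -/
def blockMatrix (f : ι → ι → Matrix κ κ ℤ) : Matrix (ι × κ) (ι × κ) ℤ :=
  Matrix.of fun x y => f x.1 y.1 x.2 y.2

theorem blockMatrix_apply (f : ι → ι → Matrix κ κ ℤ) (x y : ι × κ) :
    blockMatrix f x y = f x.1 y.1 x.2 y.2 := rfl

theorem blockMatrix_congr {f g : ι → ι → Matrix κ κ ℤ} (h : ∀ i j, f i j = g i j) :
    blockMatrix f = blockMatrix g :=
  congrArg blockMatrix (funext fun i => funext fun j => h i j)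

theorem blockMatrix_transpose (f : ι → ι → Matrix κ κ ℤ) :
    (blockMatrix f)ᵀ = blockMatrix fun i j => (f j i)ᵀ := rfl

theorem allOnes_eq_blockMatrix : allOnes (ι × κ) = blockMatrix fun _ _ => allOnes κ := rfl

variable [DecidableEq ι]

theorem one_kronecker_eq_blockMatrix (B : Matrix κ κ ℤ) :
    (1 : Matrix ι ι ℤ) ⊗ₖ B = blockMatrix fun i j => if i = j then B else 0 := by
  ext x y
  rw [Matrix.kroneckerMap_apply, blockMatrix_apply, Matrix.one_apply]
  split_ifs <;> simp

variable [Fintype ι] [Fintype κ]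

omit [DecidableEq ι] in
theorem blockMatrix_mul (f g : ι → ι → Matrix κ κ ℤ) :
    blockMatrix f * blockMatrix g = blockMatrix fun i k => ∑ j, f i j * g j k := by
  ext x y
  simp only [Matrix.mul_apply, blockMatrix_apply, Fintype.sum_prod_type, Matrix.sum_apply]

theorem blockMatrix_mul_one_kronecker (f : ι → ι → Matrix κ κ ℤ) (B : Matrix κ κ ℤ) :
    blockMatrix f * (1 : Matrix ι ι ℤ) ⊗ₖ B = blockMatrix fun i k => f i k * B := by
  rw [one_kronecker_eq_blockMatrix, blockMatrix_mul]
  refine blockMatrix_congr fun i k => ?_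
  simp

theorem one_kronecker_mul_blockMatrix (f : ι → ι → Matrix κ κ ℤ) (B : Matrix κ κ ℤ) :
    (1 : Matrix ι ι ℤ) ⊗ₖ B * blockMatrix f = blockMatrix fun i k => B * f i k := by
  rw [one_kronecker_eq_blockMatrix, blockMatrix_mul]
  refine blockMatrix_congr fun i k => ?_
  simp

end BlockMatrices

/-! ### Products of T, Z, L, M and J. -/

section TwinAlgebra

variable {n p : ℕ}

theorem IsSkewBGW.apply_self [NeZero n] {ι : Type*} {W : Matrix ι ι (WithZero (Cyc n))}
    (hs : IsSkewBGW (cycNeg n) W) (i : ι) : W i i = 0 := by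
  by_contra h
  have h1 := hs i i
  nth_rw 1 [← one_mul (W i i)] at h1
  have h2 := mul_right_cancel₀ h h1
  rw [← WithZero.coe_one, WithZero.coe_inj] at h2
  have h3 : ((2 * n : ℕ) : ZMod (4 * n)) = 0 := h2.symm
  -- A nonzero diagonal entry would force the involution to be trivial, that is, 4n to divide 2n.
  rw [ZMod.natCast_eq_zero_iff] at h3
  have := NeZero.pos n
  have := Nat.le_of_dvd (by omega) h3
  omega

/-- A row has q nonzero entries among q + 1 and its diagonal entry is zero, so all the others are
nonzero. -/
theorem IsBGW.apply_ne_zero [NeZero n] {q l : ℕ}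
    {W : Matrix (Fin (q + 1)) (Fin (q + 1)) (WithZero (Cyc n))} (hW : IsBGW (q + 1) q l W)
    (hs : IsSkewBGW (cycNeg n) W) {i j : Fin (q + 1)} (hij : i ≠ j) : W i j ≠ 0 := by
  have h1 : {j | W i j ≠ 0} ⊆ {j | j ≠ i} := fun j hj h => hj (h ▸ hs.apply_self j)
  have h2 : {j : Fin (q + 1) | j ≠ i}.ncard = q := by
    rw [Set.ncard_eq_toFinset_card']
    simp [Finset.filter_ne']
  have h3 := Set.eq_of_subset_of_ncard_le h1 (by rw [h2, hW.weight])
  exact h3.ge (show j ∈ {j | j ≠ i} from hij.symm)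

/-- The identity of order `2n(p²+1)` tensored with the all-ones matrix of order `2n`. -/
def smallOnes (n p : ℕ) : Matrix (Vertex n p) (Vertex n p) ℤ :=
  (1 : Matrix (Fin (p ^ 2 + 1)) (Fin (p ^ 2 + 1)) ℤ) ⊗ₖ
    ((1 : Matrix (Fin (2 * n)) (Fin (2 * n)) ℤ) ⊗ₖ allOnes (Fin (2 * n)))

/-- The identity of order `p²+1` tensored with the all-ones matrix of order `4n²`. -/
def bigOnes (n p : ℕ) : Matrix (Vertex n p) (Vertex n p) ℤ :=
  (1 : Matrix (Fin (p ^ 2 + 1)) (Fin (p ^ 2 + 1)) ℤ) ⊗ₖ allOnes (Fin (2 * n) × Fin (2 * n))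

/-- The positions of the zeros of the twin matrix outside the diagonal blocks. -/
noncomputable def zeroMatrix [NeZero n]
    (W : Matrix (Fin (p ^ 2 + 1)) (Fin (p ^ 2 + 1)) (WithZero (Cyc n))) :
    Matrix (Vertex n p) (Vertex n p) ℤ :=
  blockMatrix fun i j => zeroBlock (W i j)

theorem matA4_eq : matA4 n p = smallOnes n p - 1 := by
  rw [matA4, smallOnes, sub_eq_add_neg, sub_eq_add_neg, Matrix.kronecker_add,
    Matrix.kronecker_add]
  congr 1
  ext x y
  simp only [Matrix.kroneckerMap_apply, Matrix.one_apply, Matrix.neg_apply, Prod.ext_iff]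
  split_ifs <;> simp_all

theorem matA5_eq : matA5 n p = bigOnes n p - smallOnes n p := by
  ext x y
  simp [matA5, bigOnes, smallOnes, mul_sub]

theorem smallOnes_transpose : (smallOnes n p)ᵀ = smallOnes n p := by
  rw [smallOnes, ← Matrix.kroneckerMap_transpose, ← Matrix.kroneckerMap_transpose,
    Matrix.transpose_one, Matrix.transpose_one, allOnes_transpose]

theorem bigOnes_transpose : (bigOnes n p)ᵀ = bigOnes n p := by
  rw [bigOnes, ← Matrix.kroneckerMap_transpose, Matrix.transpose_one, allOnes_transpose]

theorem smallOnes_mul_smallOnes :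
    smallOnes n p * smallOnes n p = (2 * n : ℤ) • smallOnes n p := by
  rw [smallOnes, ← Matrix.mul_kronecker_mul, ← Matrix.mul_kronecker_mul, one_mul, one_mul,
    allOnes_mul_self, Matrix.kronecker_smul, Matrix.kronecker_smul, Fintype.card_fin]
  push_cast
  rfl

theorem bigOnes_mul_bigOnes :
    bigOnes n p * bigOnes n p = (4 * n ^ 2 : ℤ) • bigOnes n p := by
  rw [bigOnes, ← Matrix.mul_kronecker_mul, one_mul, allOnes_mul_self, Matrix.kronecker_smul,
    Fintype.card_prod, Fintype.card_fin]
  congr 1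
  push_cast
  ring

theorem one_kronecker_allOnes_mul_allOnes :
    (1 : Matrix (Fin (2 * n)) (Fin (2 * n)) ℤ) ⊗ₖ allOnes (Fin (2 * n)) *
      allOnes (Fin (2 * n) × Fin (2 * n)) = (2 * n : ℤ) • allOnes (Fin (2 * n) × Fin (2 * n)) := by
  rw [allOnes_prod, ← Matrix.mul_kronecker_mul, one_mul, allOnes_mul_self, Matrix.kronecker_smul,
    Fintype.card_fin]
  push_cast
  rfl

theorem smallOnes_mul_bigOnes :
    smallOnes n p * bigOnes n p = (2 * n : ℤ) • bigOnes n p := by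
  rw [bigOnes, smallOnes, ← Matrix.mul_kronecker_mul, one_mul, one_kronecker_allOnes_mul_allOnes,
    Matrix.kronecker_smul]

theorem smallOnes_mul_allOnes :
    smallOnes n p * allOnes (Vertex n p) = (2 * n : ℤ) • allOnes (Vertex n p) := by
  rw [smallOnes, allOnes_eq_blockMatrix, one_kronecker_mul_blockMatrix,
    one_kronecker_allOnes_mul_allOnes]
  rfl

theorem bigOnes_mul_allOnes :
    bigOnes n p * allOnes (Vertex n p) = (4 * n ^ 2 : ℤ) • allOnes (Vertex n p) := by
  rw [bigOnes, allOnes_eq_blockMatrix (ι := Fin (p ^ 2 + 1)) (κ := Fin (2 * n) × Fin (2 * n)),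
    one_kronecker_mul_blockMatrix, allOnes_mul_self, Fintype.card_prod, Fintype.card_fin]
  ext x y
  simp only [blockMatrix_apply, Matrix.smul_apply, allOnes_apply]
  push_cast
  simp
  ring

theorem allOnes_mul_allOnes :
    allOnes (Vertex n p) * allOnes (Vertex n p) =
      (4 * n ^ 2 * (p ^ 2 + 1) : ℤ) • allOnes (Vertex n p) := by
  rw [allOnes_mul_self]
  congr 1
  simp only [Fintype.card_prod, Fintype.card_fin]
  push_cast
  ring

theorem natCard_cyc (n : ℕ) : Nat.card (Cyc n) = 4 * n := Nat.card_zmod _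

variable [NeZero n] {K : Matrix (Fin (2 * n)) (Fin (2 * n)) ℤ}
  {W : Matrix (Fin (p ^ 2 + 1)) (Fin (p ^ 2 + 1)) (WithZero (Cyc n))}

theorem twinMatrix_eq : twinMatrix K W = blockMatrix fun i j => twinBlock K (W i j) := by
  ext x y
  rw [blockMatrix_apply, ← twinBlock_eq]
  rfl

theorem twinMatrix_transpose (hs : IsSkewBGW (cycNeg n) W) :
    (twinMatrix K W)ᵀ = -twinMatrix K W := by
  rw [twinMatrix_eq, blockMatrix_transpose]
  ext x y
  rw [blockMatrix_apply, Matrix.neg_apply, blockMatrix_apply, twinBlock_transpose, hs x.1 y.1,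
    twinBlock_neg]
  rfl

theorem zeroMatrix_transpose (hs : IsSkewBGW (cycNeg n) W) : (zeroMatrix W)ᵀ = zeroMatrix W := by
  rw [zeroMatrix, blockMatrix_transpose]
  refine blockMatrix_congr fun i j => ?_
  rw [zeroBlock_transpose, hs i j, zeroBlock_neg]

theorem twinMatrix_mul_smallOnes (hK : K.IsHadamard) : twinMatrix K W * smallOnes n p = 0 := by
  rw [twinMatrix_eq, smallOnes, blockMatrix_mul_one_kronecker]
  exact blockMatrix_congr fun i k => twinBlock_mul_kronecker_allOnes hK _ _

theorem twinMatrix_mul_bigOnes (hK : K.IsHadamard) : twinMatrix K W * bigOnes n p = 0 := by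
  rw [twinMatrix_eq, bigOnes, blockMatrix_mul_one_kronecker, allOnes_prod]
  exact blockMatrix_congr fun i k => twinBlock_mul_kronecker_allOnes hK _ _

theorem twinMatrix_mul_allOnes (hK : K.IsHadamard) :
    twinMatrix K W * allOnes (Vertex n p) = 0 := by
  rw [twinMatrix_eq, allOnes_eq_blockMatrix, blockMatrix_mul, allOnes_prod]
  exact blockMatrix_congr fun i k =>
    Finset.sum_eq_zero fun _ _ => twinBlock_mul_kronecker_allOnes hK _ _

theorem twinMatrix_mul_zeroMatrix (hK : K.IsHadamard) : twinMatrix K W * zeroMatrix W = 0 := by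
  rw [twinMatrix_eq, zeroMatrix, blockMatrix_mul]
  exact blockMatrix_congr fun i k =>
    Finset.sum_eq_zero fun _ _ => twinBlock_mul_kronecker_allOnes hK _ _

theorem zeroMatrix_mul_smallOnes :
    zeroMatrix W * smallOnes n p = (2 * n : ℤ) • zeroMatrix W := by
  rw [zeroMatrix, smallOnes, blockMatrix_mul_one_kronecker]
  refine blockMatrix_congr (g := fun i j => (2 * n : ℤ) • zeroBlock (W i j)) fun i k => ?_
  rw [zeroBlock, ← Matrix.mul_kronecker_mul, mul_one, allOnes_mul_self, Matrix.kronecker_smul,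
    Fintype.card_fin]
  push_cast
  rfl

theorem zeroBlock_mul_allOnes {w : WithZero (Cyc n)} (hw : w ≠ 0) :
    zeroBlock w * allOnes (Fin (2 * n) × Fin (2 * n)) =
      (2 * n : ℤ) • allOnes (Fin (2 * n) × Fin (2 * n)) := by
  obtain ⟨a, rfl⟩ := WithZero.ne_zero_iff_exists.1 hw
  have h : cycPow (signedShift 1) (a : WithZero (Cyc n)) * backId (2 * n) * allOnes (Fin (2 * n))
      = allOnes (Fin (2 * n)) := by
    ext i j
    -- Reindexing by the reversal undoes R and leaves a row of the shift power, whose entries sum to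
    -- 1.
    rw [Matrix.mul_apply, ← Equiv.sum_comp Fin.revPerm]
    simp [mul_backId_apply, cycPow_coe, signedShift_one_pow_apply, allOnes_apply]
  rw [zeroBlock, allOnes_prod, ← Matrix.mul_kronecker_mul, h, allOnes_mul_self,
    Matrix.kronecker_smul, Fintype.card_fin]
  push_cast
  rfl

theorem zeroBlock_apply_mul_allOnes (hW : IsBGW (p ^ 2 + 1) (p ^ 2) (p ^ 2 - 1) W)
    (hs : IsSkewBGW (cycNeg n) W) (i j : Fin (p ^ 2 + 1)) :
    zeroBlock (W i j) * allOnes (Fin (2 * n) × Fin (2 * n)) =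
      if i = j then 0 else (2 * n : ℤ) • allOnes (Fin (2 * n) × Fin (2 * n)) := by
  split_ifs with h
  · rw [h, hs.apply_self, zeroBlock_zero, zero_mul]
  · exact zeroBlock_mul_allOnes (hW.apply_ne_zero hs h)

theorem zeroMatrix_mul_bigOnes (hW : IsBGW (p ^ 2 + 1) (p ^ 2) (p ^ 2 - 1) W)
    (hs : IsSkewBGW (cycNeg n) W) :
    zeroMatrix W * bigOnes n p = (2 * n : ℤ) • (allOnes (Vertex n p) - bigOnes n p) := by
  rw [zeroMatrix, bigOnes, blockMatrix_mul_one_kronecker]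
  simp only [zeroBlock_apply_mul_allOnes hW hs]
  ext x y
  rw [blockMatrix_apply, Matrix.smul_apply, Matrix.sub_apply, Matrix.kroneckerMap_apply,
    Matrix.one_apply]
  split_ifs <;> simp [allOnes_apply]

theorem zeroMatrix_mul_allOnes (hW : IsBGW (p ^ 2 + 1) (p ^ 2) (p ^ 2 - 1) W)
    (hs : IsSkewBGW (cycNeg n) W) :
    zeroMatrix W * allOnes (Vertex n p) = (2 * n * p ^ 2 : ℤ) • allOnes (Vertex n p) := by
  rw [zeroMatrix, allOnes_eq_blockMatrix, blockMatrix_mul]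
  simp only [zeroBlock_apply_mul_allOnes hW hs]
  refine blockMatrix_congr (g := fun _ _ => (2 * n * p ^ 2 : ℤ) • allOnes _) fun i k => ?_
  rw [Finset.sum_ite, Finset.sum_const_zero, zero_add, Finset.sum_const, Finset.filter_ne,
    Finset.card_erase_of_mem (Finset.mem_univ _), Finset.card_univ, Fintype.card_fin,
    Nat.add_sub_cancel, ← natCast_zsmul, smul_smul]
  congr 1
  push_cast
  ring

/-- Skewness replaces W j k by -W k j, and the unsigned pattern ignores the sign. For i = k the p²
nonzero quotients equal 1; for i ≠ k each group element occurs λ/4n times, with λ = p² - 1 = 4n(n -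
1). -/
theorem zeroMatrix_mul_zeroMatrix (hpn : p + 1 = 2 * n)
    (hW : IsBGW (p ^ 2 + 1) (p ^ 2) (p ^ 2 - 1) W) (hs : IsSkewBGW (cycNeg n) W) :
    zeroMatrix W * zeroMatrix W = (2 * n * p ^ 2 : ℤ) • smallOnes n p +
      (4 * n * (n - 1) : ℤ) • (allOnes (Vertex n p) - bigOnes n p) := by
  let f : WithZero (Cyc n) → Matrix (Fin (2 * n) × Fin (2 * n)) (Fin (2 * n) × Fin (2 * n)) ℤ :=
    fun w => cycPow (signedShift 1) w ⊗ₖ ((2 * n : ℤ) • allOnes (Fin (2 * n)))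
  have hf : f 0 = 0 := by simp [f]
  have hn0 : ((4 * n : ℕ) : ℤ) ≠ 0 := by have := NeZero.ne n; positivity
  have hn1 := NeZero.pos n
  have hp1 : ((p ^ 2 - 1 : ℕ) : ℤ) = 4 * n * (n - 1) := by
    have : 1 ≤ p ^ 2 := Nat.one_le_pow _ _ (by omega)
    push_cast [this]
    have : (p : ℤ) = 2 * n - 1 := by linarith [(by exact_mod_cast hpn : (p : ℤ) + 1 = 2 * n)]
    rw [this]; ring
  have hsum : ∑ g : Cyc n, f g = (4 * n : ℤ) • allOnes (Fin (2 * n) × Fin (2 * n)) := by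
    have : ∑ g : Cyc n, f g = (∑ g : Cyc n, cycPow (signedShift 1) (g : WithZero (Cyc n))) ⊗ₖ
        ((2 * n : ℤ) • allOnes (Fin (2 * n))) :=
      (map_sum (AddMonoidHom.mk' (fun x => x ⊗ₖ ((2 * n : ℤ) • allOnes (Fin (2 * n))))
        fun x y => Matrix.add_kronecker x y _) _ _).symm
    rw [this, sum_cycPow_cyclicShift, allOnes_prod]
    ext x y
    simp [allOnes_apply, -zsmul_eq_mul, -nsmul_eq_mul]
    ring
  have key : ∀ i k, ∑ j, zeroBlock (W i j) * zeroBlock (W j k)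
      = if i = k then (p ^ 2 : ℤ) • f 1
        else (4 * n * (n - 1) : ℤ) • allOnes (Fin (2 * n) × Fin (2 * n)) := fun i k => by
    have : ∀ j, zeroBlock (W i j) * zeroBlock (W j k) = f (W i j * (W k j)⁻¹) := fun j => by
      rw [hs k j, zeroBlock_neg, zeroBlock_mul_zeroBlock]
    rw [Finset.sum_congr rfl fun j _ => this j]
    split_ifs with h
    · subst h
      rw [hW.sum_self hf, ← natCast_zsmul]
      push_cast
      rfl
    · have h1 := hW.sum_ne hf h
      rw [hsum, natCard_cyc, ← natCast_zsmul, ← natCast_zsmul, hp1, smul_comm] at h1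
      -- The group order 4n is cancelled against the factor 4n of `hsum`.
      refine smul_right_injective _ hn0 (h1.trans ?_)
      push_cast
      rfl
  rw [zeroMatrix, blockMatrix_mul]
  simp only [key]
  ext x y
  simp only [blockMatrix_apply, smallOnes, bigOnes, Matrix.add_apply, Matrix.smul_apply,
    Matrix.sub_apply, Matrix.kroneckerMap_apply, allOnes_apply, f, cycPow_one, Matrix.one_apply]
  split_ifs <;> simp [allOnes_apply, Matrix.one_apply, -zsmul_eq_mul, *]
  ring

/-- Here skewness contributes a minus sign, and the off-diagonal blocks vanish because the group
elements sum to zero. -/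
theorem twinMatrix_mul_twinMatrix (hK : K.IsHadamard)
    (hW : IsBGW (p ^ 2 + 1) (p ^ 2) (p ^ 2 - 1) W) (hs : IsSkewBGW (cycNeg n) W) :
    twinMatrix K W * twinMatrix K W =
      (2 * n * p ^ 2 : ℤ) • (smallOnes n p - (2 * n : ℤ) • 1) := by
  let B : Matrix (Fin (2 * n)) (Fin (2 * n)) ℤ :=
    (2 * n : ℤ) • ((2 * n : ℤ) • 1 - allOnes (Fin (2 * n)))
  let f : WithZero (Cyc n) → Matrix (Fin (2 * n) × Fin (2 * n)) (Fin (2 * n) × Fin (2 * n)) ℤ :=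
    fun w => cycPow (negaShift n) w ⊗ₖ B
  have hf : f 0 = 0 := by simp [f]
  have hn0 : ((4 * n : ℕ) : ℤ) ≠ 0 := by have := NeZero.ne n; positivity
  have hsum : ∑ g : Cyc n, f g = 0 := by
    have : ∑ g : Cyc n, f g = (∑ g : Cyc n, cycPow (negaShift n) (g : WithZero (Cyc n))) ⊗ₖ B :=
      (map_sum (AddMonoidHom.mk' (fun x => x ⊗ₖ B)
        fun x y => Matrix.add_kronecker x y _) _ _).symm
    rw [this, sum_cycPow_negaShift, Matrix.zero_kronecker]
  have key : ∀ i k, ∑ j, twinBlock K (W i j) * twinBlock K (W j k)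
      = if i = k then -((p ^ 2 : ℤ) • f 1) else 0 := fun i k => by
    have : ∀ j, twinBlock K (W i j) * twinBlock K (W j k) = -f (W i j * (W k j)⁻¹) := fun j => by
      rw [hs k j, twinBlock_neg, mul_neg, twinBlock_mul_twinBlock hK]
    rw [Finset.sum_congr rfl fun j _ => this j, Finset.sum_neg_distrib]
    split_ifs with h
    · subst h
      rw [hW.sum_self hf, ← natCast_zsmul]
      push_cast
      rfl
    · have h1 := hW.sum_ne hf h
      rw [hsum, natCard_cyc, ← natCast_zsmul, smul_zero] at h1
      rw [(smul_eq_zero.1 h1).resolve_left hn0, neg_zero]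
  rw [twinMatrix_eq, blockMatrix_mul]
  simp only [key]
  ext ⟨x, x', x''⟩ ⟨y, y', y''⟩
  simp only [blockMatrix_apply, smallOnes, Matrix.smul_apply, Matrix.sub_apply,
    Matrix.kroneckerMap_apply, allOnes_apply, Matrix.one_apply, Prod.mk.injEq]
  by_cases h : x = y <;> by_cases h' : x' = y' <;> by_cases h'' : x'' = y'' <;>
    simp [h, h', h'', f, B, allOnes_apply, -zsmul_eq_mul, -zsmul_one] <;> ring

theorem plusTwin_add_minusTwin (hK : K.IsHadamard)
    (hW : IsBGW (p ^ 2 + 1) (p ^ 2) (p ^ 2 - 1) W) (hs : IsSkewBGW (cycNeg n) W) :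
    plusTwin K W + minusTwin K W = allOnes (Vertex n p) - bigOnes n p - zeroMatrix W := by
  ext x y
  simp only [plusTwin, minusTwin, twinMatrix_eq, zeroMatrix, bigOnes, Matrix.add_apply,
    Matrix.sub_apply, Matrix.of_apply, blockMatrix_apply, Matrix.kroneckerMap_apply,
    allOnes_apply, Matrix.one_apply]
  by_cases h : x.1 = y.1
  · simp [h, hs.apply_self]
  · obtain ⟨a, ha⟩ := WithZero.ne_zero_iff_exists.1 (hW.apply_ne_zero hs h)
    have h1 := twinBlock_coe_apply hK a x.2 y.2
    rw [← ha, zeroBlock_coe_apply, if_neg h]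
    split_ifs at h1 ⊢ <;> omega

theorem plusTwin_sub_minusTwin (hK : K.IsHadamard)
    (hW : IsBGW (p ^ 2 + 1) (p ^ 2) (p ^ 2 - 1) W) (hs : IsSkewBGW (cycNeg n) W) :
    plusTwin K W - minusTwin K W = twinMatrix K W := by
  ext x y
  simp only [plusTwin, minusTwin, twinMatrix_eq, Matrix.sub_apply, Matrix.of_apply,
    blockMatrix_apply]
  by_cases h : x.1 = y.1
  · simp [h, hs.apply_self]
  · obtain ⟨a, ha⟩ := WithZero.ne_zero_iff_exists.1 (hW.apply_ne_zero hs h)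
    have h1 := twinBlock_coe_apply hK a x.2 y.2
    rw [← ha]
    split_ifs at h1 ⊢ <;> omega

/-- The complement of the other relations is thus exactly the zero pattern, whose products are
known. -/
theorem matA3_eq (hK : K.IsHadamard)
    (hW : IsBGW (p ^ 2 + 1) (p ^ 2) (p ^ 2 - 1) W) (hs : IsSkewBGW (cycNeg n) W) :
    matA3 K W = zeroMatrix W := by
  rw [matA3, matA4_eq, matA5_eq, sub_sub _ (plusTwin K W), plusTwin_add_minusTwin hK hW hs]
  abel

theorem plusTwin_transpose (hs : IsSkewBGW (cycNeg n) W) :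
    (plusTwin K W)ᵀ = minusTwin K W := by
  ext x y
  have h := congrFun (congrFun (twinMatrix_transpose (K := K) hs) x) y
  rw [Matrix.transpose_apply, Matrix.neg_apply] at h
  simp only [Matrix.transpose_apply, plusTwin, minusTwin, Matrix.of_apply, h]
  exact if_congr neg_eq_iff_eq_neg rfl rfl

end TwinAlgebra

/-! ### From the relations of T, Z, L, M, J to the intersection numbers. -/

section Algebra

/-- The multiplication table of the twin matrix `T`, the zero pattern `Z`, the block diagonal
matrices `L` and `M`, and the all-ones matrix `J`. -/
structure TwinRelations {A : Type*} [Ring A] (m : ℤ) (T Z L M J : A) : Prop where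
  TT : T * T = (2 * m * (2 * m - 1) ^ 2) • (L - (2 * m) • 1)
  TZ : T * Z = 0
  ZT : Z * T = 0
  TL : T * L = 0
  LT : L * T = 0
  TM : T * M = 0
  MT : M * T = 0
  TJ : T * J = 0
  JT : J * T = 0
  ZZ : Z * Z = (2 * m * (2 * m - 1) ^ 2) • L + (4 * m * (m - 1)) • (J - M)
  ZL : Z * L = (2 * m) • Z
  LZ : L * Z = (2 * m) • Z
  ZM : Z * M = (2 * m) • (J - M)
  MZ : M * Z = (2 * m) • (J - M)
  ZJ : Z * J = (2 * m * (2 * m - 1) ^ 2) • J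
  JZ : J * Z = (2 * m * (2 * m - 1) ^ 2) • J
  LL : L * L = (2 * m) • L
  LM : L * M = (2 * m) • M
  ML : M * L = (2 * m) • M
  LJ : L * J = (2 * m) • J
  JL : J * L = (2 * m) • J
  MM : M * M = (4 * m ^ 2) • M
  MJ : M * J = (4 * m ^ 2) • J
  JM : J * M = (4 * m ^ 2) • J
  JJ : J * J = (4 * m ^ 2 * ((2 * m - 1) ^ 2 + 1)) • J

/-- The intersection numbers of the scheme. -/
structure TwinTable {A : Type*} [Ring A] (m : ℤ) (A₀ A₁ A₂ A₃ A₄ A₅ J : A) : Prop where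
  h11 : A₁ * A₁ = ((m - 1) * (2 * m - 1) * (2 * m ^ 2 - m)) • (A₁ + A₂ + A₃ + A₅)
    + (m ^ 2 * (2 * m - 1) ^ 2) • A₄
  h22 : A₂ * A₂ = ((m - 1) * (2 * m - 1) * (2 * m ^ 2 - m)) • (A₁ + A₂ + A₃ + A₅)
    + (m ^ 2 * (2 * m - 1) ^ 2) • A₄
  h12 : A₁ * A₂ = (m ^ 2 * (2 * m - 1) ^ 2) • A₀ + ((2 * m - 1) ^ 2 * (m ^ 2 - m)) • J
  h13 : A₁ * A₃ = (2 * m * (m - 1) * (2 * m - 1)) • (A₁ + A₂ + A₃) + (m * (2 * m - 1) ^ 2) • A₅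
  h23 : A₂ * A₃ = (2 * m * (m - 1) * (2 * m - 1)) • (A₁ + A₂ + A₃) + (m * (2 * m - 1) ^ 2) • A₅
  h14 : A₁ * A₄ = (m - 1) • A₁ + m • A₂
  h15 : A₁ * A₅ = (2 * m * (m - 1)) • (A₁ + A₂) + (m * (2 * m - 1)) • A₃
  h25 : A₂ * A₅ = (2 * m * (m - 1)) • (A₁ + A₂) + (m * (2 * m - 1)) • A₃
  h24 : A₂ * A₄ = m • A₁ + (m - 1) • A₂
  h33 : A₃ * A₃ = (2 * m * (2 * m - 1) ^ 2) • A₀ + (4 * m * (m - 1)) • (A₁ + A₂ + A₃)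
    + (2 * m * (2 * m - 1) ^ 2) • A₄
  h34 : A₃ * A₄ = (2 * m - 1) • A₃
  h35 : A₃ * A₅ = (2 * m) • (A₁ + A₂)
  h44 : A₄ * A₄ = (2 * m - 1) • A₀ + (2 * m - 2) • A₄
  h45 : A₄ * A₅ = (2 * m - 1) • A₅
  h55 : A₅ * A₅ = (2 * m * (2 * m - 1)) • A₀ + (2 * m * (2 * m - 1)) • A₄
    + (4 * m * (m - 1)) • A₅

variable {A : Type*} [Ring A] {m : ℤ} {T Z L M J A₁ A₂ : A}

theorem two_smul_of_add_of_sub (hadd : A₁ + A₂ = J - M - Z) (hsub : A₁ - A₂ = T) :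
    (2 : ℤ) • A₁ = J - M - Z + T ∧ (2 : ℤ) • A₂ = J - M - Z - T := by
  rw [← hadd, ← hsub]; constructor <;> module

theorem TwinRelations.table [IsAddTorsionFree A] (h : TwinRelations m T Z L M J)
    (hadd : A₁ + A₂ = J - M - Z) (hsub : A₁ - A₂ = T) :
    TwinTable m 1 A₁ A₂ Z (L - 1) (M - L) J := by
  obtain ⟨h1, h2⟩ := two_smul_of_add_of_sub hadd hsub
  -- Products with one factor A₁ or A₂ are compared after doubling, products with two such factors
  -- after multiplying by four.
  have c2 : ∀ {x y : A}, (2 : ℤ) • x = (2 : ℤ) • y → x = y :=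
    fun h => zsmul_right_injective two_ne_zero h
  have c4 : ∀ {x y : A}, (2 : ℤ) • (2 : ℤ) • x = (2 : ℤ) • (2 : ℤ) • y → x = y :=
    fun h => c2 (c2 h)
  constructor
  · apply c4
    rw [← smul_mul_assoc, ← mul_smul_comm, h1]
    simp only [mul_add, add_mul, mul_sub, sub_mul, h.TT, h.TZ, h.ZT, h.TM, h.MT, h.TJ, h.JT,
      h.ZZ, h.ZM, h.MZ, h.ZJ, h.JZ, h.MM, h.MJ, h.JM, h.JJ, hadd]
    module
  · apply c4
    rw [← smul_mul_assoc, ← mul_smul_comm, h2]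
    simp only [mul_add, mul_sub, sub_mul, h.TT, h.TZ, h.ZT, h.TM, h.MT, h.TJ, h.JT,
      h.ZZ, h.ZM, h.MZ, h.ZJ, h.JZ, h.MM, h.MJ, h.JM, h.JJ, hadd]
    module
  · apply c4
    rw [← smul_mul_assoc, ← mul_smul_comm, h1, h2]
    simp only [mul_add, add_mul, mul_sub, sub_mul, h.TT, h.TZ, h.ZT, h.TM, h.MT, h.TJ, h.JT,
      h.ZZ, h.ZM, h.MZ, h.ZJ, h.JZ, h.MM, h.MJ, h.JM, h.JJ]
    module
  · apply c2
    rw [← smul_mul_assoc, h1, hadd]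
    simp only [add_mul, sub_mul, h.TZ, h.ZZ, h.MZ, h.JZ]
    module
  · apply c2
    rw [← smul_mul_assoc, h2, hadd]
    simp only [sub_mul, h.TZ, h.ZZ, h.MZ, h.JZ]
    module
  · apply c2
    rw [← smul_mul_assoc, smul_add, smul_comm _ _ A₁, smul_comm _ _ A₂, h1, h2]
    simp only [add_mul, mul_sub, sub_mul, mul_one, h.TL, h.ZL, h.ML, h.JL]
    module
  · apply c2
    rw [← smul_mul_assoc, h1, hadd]
    simp only [add_mul, mul_sub, sub_mul, h.TL, h.ZL, h.ML, h.JL, h.TM, h.ZM, h.MM, h.JM]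
    module
  · apply c2
    rw [← smul_mul_assoc, h2, hadd]
    simp only [mul_sub, sub_mul, h.TL, h.ZL, h.ML, h.JL, h.TM, h.ZM, h.MM, h.JM]
    module
  · apply c2
    rw [← smul_mul_assoc, smul_add, smul_comm _ _ A₁, smul_comm _ _ A₂, h1, h2]
    simp only [mul_sub, sub_mul, mul_one, h.TL, h.ZL, h.ML, h.JL]
    module
  · rw [h.ZZ, hadd]; module
  · rw [mul_sub, h.ZL, mul_one]; module
  · rw [mul_sub, h.ZM, h.ZL, hadd]; module
  · simp only [mul_sub, sub_mul, h.LL, mul_one, one_mul]; module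
  · simp only [mul_sub, sub_mul, h.LL, h.LM, one_mul]; module
  · simp only [mul_sub, sub_mul, h.LL, h.LM, h.ML, h.MM]; module

/-- T, Z, L, M and J commute pairwise, and commutation passes to A₁ and A₂ by cancelling the factor
2. -/
theorem TwinRelations.commute [IsAddTorsionFree A] (h : TwinRelations m T Z L M J)
    (hadd : A₁ + A₂ = J - M - Z) (hsub : A₁ - A₂ = T) (i j : Fin 6) :
    Commute (![1, A₁, A₂, Z, L - 1, M - L] i) (![1, A₁, A₂, Z, L - 1, M - L] j) := by
  obtain ⟨h1, h2⟩ := two_smul_of_add_of_sub hadd hsub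
  have hTZ : Commute T Z := h.TZ.trans h.ZT.symm
  have hTL : Commute T L := h.TL.trans h.LT.symm
  have hTM : Commute T M := h.TM.trans h.MT.symm
  have hTJ : Commute T J := h.TJ.trans h.JT.symm
  have hZL : Commute Z L := h.ZL.trans h.LZ.symm
  have hZM : Commute Z M := h.ZM.trans h.MZ.symm
  have hZJ : Commute Z J := h.ZJ.trans h.JZ.symm
  have hLM : Commute L M := h.LM.trans h.ML.symm
  have hLJ : Commute L J := h.LJ.trans h.JL.symm
  have hMJ : Commute M J := h.MJ.trans h.JM.symm
  have hcancel : ∀ {x y : A}, Commute ((2 : ℤ) • x) y → Commute x y := fun {x y} h => by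
    refine zsmul_right_injective (two_ne_zero (α := ℤ)) ?_
    change (2 : ℤ) • (x * y) = (2 : ℤ) • (y * x)
    rw [← smul_mul_assoc, ← mul_smul_comm, h.eq]
  have hX : ∀ y, Commute T y → Commute Z y → Commute M y → Commute J y →
      Commute A₁ y ∧ Commute A₂ y := fun y a b c d =>
    ⟨hcancel (h1 ▸ ((d.sub_left c).sub_left b).add_left a),
      hcancel (h2 ▸ ((d.sub_left c).sub_left b).sub_left a)⟩
  obtain ⟨hT1, hT2⟩ := hX T (.refl _) hTZ.symm hTM.symm hTJ.symm
  obtain ⟨hZ1, hZ2⟩ := hX Z hTZ (.refl _) hZM.symm hZJ.symm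
  obtain ⟨hL1, hL2⟩ := hX L hTL hZL hLM.symm hLJ.symm
  obtain ⟨hM1, hM2⟩ := hX M hTM hZM (.refl _) hMJ.symm
  obtain ⟨hJ1, hJ2⟩ := hX J hTJ hZJ hMJ (.refl _)
  -- A second use of `hX`, now with y = A₁, which commutes with T, Z, M and J by the first.
  have h12 : Commute A₂ A₁ := (hX A₁ hT1.symm hZ1.symm hM1.symm hJ1.symm).2
  have one : ∀ x : A, Commute 1 x := Commute.one_left
  have h14 := hL1.sub_right (one A₁).symm
  have h24 := hL2.sub_right (one A₂).symm
  have h34 := hZL.sub_right (one Z).symm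
  have h15 := hM1.sub_right hL1
  have h25 := hM2.sub_right hL2
  have h35 := hZM.sub_right hZL
  have h45 : Commute (L - 1) (M - L) :=
    (hLM.sub_right (.refl L)).sub_left (one _)
  fin_cases i <;> fin_cases j <;>
  first
    | exact Commute.refl _ | exact one _ | exact (one _).symm
    | exact h12 | exact h12.symm | exact hZ1 | exact hZ1.symm | exact hZ2 | exact hZ2.symm
    | exact h14 | exact h14.symm | exact h24 | exact h24.symm | exact h34 | exact h34.symm
    | exact h15 | exact h15.symm | exact h25 | exact h25.symm | exact h35 | exact h35.symm
    | exact h45 | exact h45.symm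

theorem TwinTable.mul_mem {A₃ A₄ A₅ : A} (h : TwinTable m 1 A₁ A₂ A₃ A₄ A₅ J)
    (hJ : ∑ i, ![1, A₁, A₂, A₃, A₄, A₅] i = J)
    (hc : ∀ i j, Commute (![1, A₁, A₂, A₃, A₄, A₅] i) (![1, A₁, A₂, A₃, A₄, A₅] j))
    (i j : Fin 6) : ∃ c : Fin 6 → ℤ, ![1, A₁, A₂, A₃, A₄, A₅] i * ![1, A₁, A₂, A₃, A₄, A₅] j
      = ∑ k, c k • ![1, A₁, A₂, A₃, A₄, A₅] k := by
  set S := Submodule.span ℤ (Set.range ![1, A₁, A₂, A₃, A₄, A₅]) with hS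
  -- Commutativity reduces the claim to i ≤ j, the cases listed in the table. J lies in the span as
  -- the sum of all the matrices.
  suffices H : ∀ i j, i ≤ j →
      ![1, A₁, A₂, A₃, A₄, A₅] i * ![1, A₁, A₂, A₃, A₄, A₅] j ∈ S by
    have H' : ![1, A₁, A₂, A₃, A₄, A₅] i * ![1, A₁, A₂, A₃, A₄, A₅] j ∈ S := by
      rcases le_total i j with hij | hij
      · exact H i j hij
      · rw [(hc i j).eq]; exact H j i hij
    obtain ⟨c, hc⟩ := (Submodule.mem_span_range_iff_exists_fun ℤ).1 H'
    exact ⟨c, hc.symm⟩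
  have hm : ∀ i, ![1, A₁, A₂, A₃, A₄, A₅] i ∈ S := fun i => Submodule.subset_span ⟨i, rfl⟩
  have hJS : J ∈ S := hJ ▸ Submodule.sum_mem _ fun i _ => hm i
  have m0 : 1 ∈ S := hm 0
  have m1 : A₁ ∈ S := hm 1
  have m2 : A₂ ∈ S := hm 2
  have m3 : A₃ ∈ S := hm 3
  have m4 : A₄ ∈ S := hm 4
  have m5 : A₅ ∈ S := hm 5
  have add : ∀ {x y}, x ∈ S → y ∈ S → x + y ∈ S := S.add_mem
  have smul : ∀ (c : ℤ) {x}, x ∈ S → c • x ∈ S := fun c _ hx => S.smul_mem c hx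
  have h0 : ∀ j, 1 * ![1, A₁, A₂, A₃, A₄, A₅] j ∈ S := fun j => by rw [one_mul]; exact hm j
  have h11 : A₁ * A₁ ∈ S := h.h11 ▸ add (smul _ (add (add (add m1 m2) m3) m5)) (smul _ m4)
  have h12 : A₁ * A₂ ∈ S := h.h12 ▸ add (smul _ m0) (smul _ hJS)
  have h13 : A₁ * A₃ ∈ S := h.h13 ▸ add (smul _ (add (add m1 m2) m3)) (smul _ m5)
  have h14 : A₁ * A₄ ∈ S := h.h14 ▸ add (smul _ m1) (smul _ m2)
  have h15 : A₁ * A₅ ∈ S := h.h15 ▸ add (smul _ (add m1 m2)) (smul _ m3)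
  have h22 : A₂ * A₂ ∈ S := h.h22 ▸ add (smul _ (add (add (add m1 m2) m3) m5)) (smul _ m4)
  have h23 : A₂ * A₃ ∈ S := h.h23 ▸ add (smul _ (add (add m1 m2) m3)) (smul _ m5)
  have h24 : A₂ * A₄ ∈ S := h.h24 ▸ add (smul _ m1) (smul _ m2)
  have h25 : A₂ * A₅ ∈ S := h.h25 ▸ add (smul _ (add m1 m2)) (smul _ m3)
  have h33 : A₃ * A₃ ∈ S :=
    h.h33 ▸ add (add (smul _ m0) (smul _ (add (add m1 m2) m3))) (smul _ m4)
  have h34 : A₃ * A₄ ∈ S := h.h34 ▸ smul _ m3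
  have h35 : A₃ * A₅ ∈ S := h.h35 ▸ smul _ (add m1 m2)
  have h44 : A₄ * A₄ ∈ S := h.h44 ▸ add (smul _ m0) (smul _ m4)
  have h45 : A₄ * A₅ ∈ S := h.h45 ▸ smul _ m5
  have h55 : A₅ * A₅ ∈ S := h.h55 ▸ add (add (smul _ m0) (smul _ m4)) (smul _ m5)
  intro i j hij
  fin_cases i <;> fin_cases j <;>
  first
    | exact absurd hij (by decide) | exact h0 _
    | exact h11 | exact h12 | exact h13 | exact h14 | exact h15 | exact h22 | exact h23
    | exact h24 | exact h25 | exact h33 | exact h34 | exact h35 | exact h44 | exact h45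
    | exact h55

end Algebra

/-! ### The association scheme axioms. -/

section Scheme

instance matrix_isAddTorsionFree {X Y : Type*} : IsAddTorsionFree (Matrix X Y ℤ) :=
  inferInstanceAs (IsAddTorsionFree (X → Y → ℤ))

variable {n p : ℕ} [NeZero n] {K : Matrix (Fin (2 * n)) (Fin (2 * n)) ℤ}
  {W : Matrix (Fin (p ^ 2 + 1)) (Fin (p ^ 2 + 1)) (WithZero (Cyc n))}

theorem twinRelations (hpn : p + 1 = 2 * n) (hK : K.IsHadamard)
    (hW : IsBGW (p ^ 2 + 1) (p ^ 2) (p ^ 2 - 1) W) (hs : IsSkewBGW (cycNeg n) W) :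
    TwinRelations (n : ℤ) (twinMatrix K W) (zeroMatrix W) (smallOnes n p) (bigOnes n p)
      (allOnes (Vertex n p)) := by
  have hp : (2 * n - 1 : ℤ) = p := by
    linarith [(by exact_mod_cast hpn : (p : ℤ) + 1 = 2 * n)]
  have hT := twinMatrix_transpose (K := K) hs
  have hZ := zeroMatrix_transpose hs
  have hL := smallOnes_transpose (n := n) (p := p)
  have hM := bigOnes_transpose (n := n) (p := p)
  have hJ := allOnes_transpose (Vertex n p)
  -- The products in reverse order come from transposing: all factors are symmetric except T, which
  -- is antisymmetric (`swapT`).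
  have swap : ∀ {B C D : Matrix (Vertex n p) (Vertex n p) ℤ}, Bᵀ = B → Cᵀ = C → Dᵀ = D →
      B * C = D → C * B = D := fun {B C D} hB hC hD h => by
    rw [← hB, ← hC, ← Matrix.transpose_mul, h, hD]
  have swapT : ∀ {B : Matrix (Vertex n p) (Vertex n p) ℤ}, Bᵀ = B →
      twinMatrix K W * B = 0 → B * twinMatrix K W = 0 := fun {B} hB h => by
    rw [← neg_eq_zero, ← mul_neg, ← hT, ← hB, ← Matrix.transpose_mul, h, Matrix.transpose_zero]
  have smulT : ∀ (c : ℤ) {B : Matrix (Vertex n p) (Vertex n p) ℤ}, Bᵀ = B → (c • B)ᵀ = c • B :=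
    fun c B hB => by rw [Matrix.transpose_smul, hB]
  have hJM : (allOnes (Vertex n p) - bigOnes n p)ᵀ = allOnes (Vertex n p) - bigOnes n p := by
    rw [Matrix.transpose_sub, hJ, hM]
  refine
    { TT := ?_
      TZ := twinMatrix_mul_zeroMatrix hK
      ZT := swapT hZ (twinMatrix_mul_zeroMatrix hK)
      TL := twinMatrix_mul_smallOnes hK
      LT := swapT hL (twinMatrix_mul_smallOnes hK)
      TM := twinMatrix_mul_bigOnes hK
      MT := swapT hM (twinMatrix_mul_bigOnes hK)
      TJ := twinMatrix_mul_allOnes hK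
      JT := swapT hJ (twinMatrix_mul_allOnes hK)
      ZZ := ?_
      ZL := zeroMatrix_mul_smallOnes
      LZ := swap hZ hL (smulT _ hZ) zeroMatrix_mul_smallOnes
      ZM := zeroMatrix_mul_bigOnes hW hs
      MZ := swap hZ hM (smulT _ hJM) (zeroMatrix_mul_bigOnes hW hs)
      ZJ := ?_
      JZ := ?_
      LL := smallOnes_mul_smallOnes
      LM := smallOnes_mul_bigOnes
      ML := swap hL hM (smulT _ hM) smallOnes_mul_bigOnes
      LJ := smallOnes_mul_allOnes
      JL := swap hL hJ (smulT _ hJ) smallOnes_mul_allOnes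
      MM := bigOnes_mul_bigOnes
      MJ := bigOnes_mul_allOnes
      JM := swap hM hJ (smulT _ hJ) bigOnes_mul_allOnes
      JJ := ?_ }
  · rw [hp]; exact twinMatrix_mul_twinMatrix hK hW hs
  · rw [hp]; exact zeroMatrix_mul_zeroMatrix hpn hW hs
  · rw [hp]; exact zeroMatrix_mul_allOnes hW hs
  · rw [hp]; exact swap hZ hJ (smulT _ hJ) (zeroMatrix_mul_allOnes hW hs)
  · rw [hp]; exact allOnes_mul_allOnes

theorem isAssociationScheme_twin (hpn : p + 1 = 2 * n) (hp2 : 2 ≤ p) (hK : K.IsHadamard)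
    (hW : IsBGW (p ^ 2 + 1) (p ^ 2) (p ^ 2 - 1) W) (hs : IsSkewBGW (cycNeg n) W) :
    IsAssociationScheme 5
        ![1, plusTwin K W, minusTwin K W, zeroMatrix W, smallOnes n p - 1,
          bigOnes n p - smallOnes n p] ∧
      plusTwin K W ≠ 0 := by
  have hadd := plusTwin_add_minusTwin hK hW hs
  have hsub := plusTwin_sub_minusTwin hK hW hs
  have hrel := twinRelations hpn hK hW hs
  have ht := hrel.table hadd hsub
  have hcomm := hrel.commute hadd hsub
  have hn : (2 : ℤ) ≤ n := by
    have : 2 ≤ n := by omega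
    exact_mod_cast this
  have hsum : ∑ i, ![1, plusTwin K W, minusTwin K W, zeroMatrix W, smallOnes n p - 1,
      bigOnes n p - smallOnes n p] i = allOnes (Vertex n p) := by
    rw [Fin.sum_univ_six]
    change 1 + plusTwin K W + minusTwin K W + zeroMatrix W + (smallOnes n p - 1) +
      (bigOnes n p - smallOnes n p) = _
    rw [add_assoc 1 (plusTwin K W), hadd]
    abel
  let x : Vertex n p := (0, 0, 0)
  have hL : smallOnes n p x x = 1 := by simp [smallOnes, allOnes_apply]
  have hM : bigOnes n p x x = 1 := by simp [bigOnes, allOnes_apply]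
  -- A matrix is shown to be nonzero by a positive diagonal entry in a product from the table.
  have hne : ∀ {B C D : Matrix (Vertex n p) (Vertex n p) ℤ}, B * C = D → D x x ≠ 0 → B ≠ 0 := by
    rintro B C D h hD rfl
    rw [zero_mul] at h
    exact hD (by rw [← h]; rfl)
  have hz : zeroMatrix W x x = 0 := by
    rw [zeroMatrix, blockMatrix_apply, hs.apply_self, zeroBlock_zero]; rfl
  have ht' : twinMatrix K W x x = 0 := by
    rw [twinMatrix_eq, blockMatrix_apply, hs.apply_self, twinBlock_zero]; rfl
  have hp1 : plusTwin K W x x = 0 := by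
    rw [plusTwin, Matrix.of_apply, ht']; rfl
  have hm1 : minusTwin K W x x = 0 := by
    rw [minusTwin, Matrix.of_apply, ht']; rfl
  have hpos : 0 < (2 * n - 1 : ℤ) := by linarith
  have hplus : plusTwin K W ≠ 0 := by
    refine hne ht.h12 ?_
    rw [Matrix.add_apply, Matrix.smul_apply, Matrix.smul_apply, Matrix.one_apply_eq,
      allOnes_apply]
    have : 0 < (n ^ 2 - n : ℤ) := by nlinarith
    simp only [smul_eq_mul, mul_one]
    positivity
  have hminus : minusTwin K W ≠ 0 := by
    rw [← plusTwin_transpose hs]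
    exact fun h => hplus (by simpa using h)
  have hzero : zeroMatrix W ≠ 0 := by
    refine hne ht.h33 ?_
    simp only [Matrix.add_apply, Matrix.smul_apply, Matrix.one_apply_eq, Matrix.sub_apply, hL, hz,
      hp1, hm1, smul_eq_mul]
    have : 0 < (2 * n * (2 * n - 1) ^ 2 : ℤ) := by positivity
    linarith
  have h4 : smallOnes n p - 1 ≠ 0 := by
    refine hne ht.h44 ?_
    simp only [Matrix.add_apply, Matrix.smul_apply, Matrix.one_apply_eq, Matrix.sub_apply, hL,
      smul_eq_mul]
    linarith
  have h5 : bigOnes n p - smallOnes n p ≠ 0 := by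
    refine hne ht.h55 ?_
    simp only [Matrix.add_apply, Matrix.smul_apply, Matrix.one_apply_eq, Matrix.sub_apply, hL, hM,
      smul_eq_mul]
    have : 0 < (2 * n * (2 * n - 1) : ℤ) := by positivity
    linarith
  refine ⟨⟨?_, ?_, rfl, hsum, ?_, ht.mul_mem hsum hcomm, fun i j => (hcomm i j).eq⟩, hplus⟩
  · have z0 : ∀ x y, (1 : Matrix (Vertex n p) (Vertex n p) ℤ) x y = 0 ∨
        (1 : Matrix (Vertex n p) (Vertex n p) ℤ) x y = 1 := fun x y => by
      rw [Matrix.one_apply]; split_ifs <;> simp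
    have z1 : ∀ x y, plusTwin K W x y = 0 ∨ plusTwin K W x y = 1 := fun x y => by
      rw [plusTwin, Matrix.of_apply]; split_ifs <;> simp
    have z2 : ∀ x y, minusTwin K W x y = 0 ∨ minusTwin K W x y = 1 := fun x y => by
      rw [minusTwin, Matrix.of_apply]; split_ifs <;> simp
    have z3 : ∀ x y, zeroMatrix W x y = 0 ∨ zeroMatrix W x y = 1 := fun x y => by
      rw [zeroMatrix, blockMatrix_apply]
      induction W x.1 y.1 with
      | zero => simp
      | coe a => rw [zeroBlock_coe_apply]; split_ifs <;> simp
    have z4 : ∀ x y, (smallOnes n p - 1) x y = 0 ∨ (smallOnes n p - 1) x y = 1 := fun x y => by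
      simp only [smallOnes, Matrix.sub_apply, Matrix.kroneckerMap_apply, Matrix.one_apply,
        allOnes_apply, Prod.ext_iff]
      split_ifs <;> simp_all
    have z5 : ∀ x y, (bigOnes n p - smallOnes n p) x y = 0 ∨
        (bigOnes n p - smallOnes n p) x y = 1 := fun x y => by
      simp only [smallOnes, bigOnes, Matrix.sub_apply, Matrix.kroneckerMap_apply,
        Matrix.one_apply, allOnes_apply]
      split_ifs <;> simp
    intro i
    fin_cases i
    exacts [z0, z1, z2, z3, z4, z5]
  · intro i
    fin_cases i
    exacts [fun h => one_ne_zero ((Matrix.one_apply_eq x).symm.trans (congrFun (congrFun h x) x)), hplus,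
      hminus, hzero, h4, h5]
  · have t4 : (smallOnes n p - 1)ᵀ = smallOnes n p - 1 := by
      rw [Matrix.transpose_sub, smallOnes_transpose, Matrix.transpose_one]
    have t5 : (bigOnes n p - smallOnes n p)ᵀ = bigOnes n p - smallOnes n p := by
      rw [Matrix.transpose_sub, smallOnes_transpose, bigOnes_transpose]
    intro i
    fin_cases i
    exacts [⟨0, Matrix.transpose_one⟩, ⟨2, plusTwin_transpose hs⟩,
      ⟨1, by
        change (minusTwin K W)ᵀ = plusTwin K W
        rw [← plusTwin_transpose hs, Matrix.transpose_transpose]⟩,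
      ⟨3, zeroMatrix_transpose hs⟩, ⟨4, t4⟩, ⟨5, t5⟩]

end Scheme

theorem mainTheorem5 (n p : ℕ) [NeZero n] (hpn : p + 1 = 2 * n) (hp : IsPrimePow p)
    (K : Matrix (Fin (2 * n)) (Fin (2 * n)) ℤ) (hK : K.IsHadamard) :
    (∃ W : Matrix (Fin (p ^ 2 + 1)) (Fin (p ^ 2 + 1)) (WithZero (Cyc n)),
      IsBGW (p ^ 2 + 1) (p ^ 2) (p ^ 2 - 1) W ∧ IsSkewBGW (cycNeg n) W) ∧
    ∀ W : Matrix (Fin (p ^ 2 + 1)) (Fin (p ^ 2 + 1)) (WithZero (Cyc n)),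
      IsBGW (p ^ 2 + 1) (p ^ 2) (p ^ 2 - 1) W → IsSkewBGW (cycNeg n) W →
      ∀ A₀ A₁ A₂ A₃ A₄ A₅ J : Matrix (Vertex n p) (Vertex n p) ℤ,
        A₀ = 1 → A₁ = plusTwin K W → A₂ = minusTwin K W → A₃ = matA3 K W →
        A₄ = matA4 n p → A₅ = matA5 n p → J = allOnes (Vertex n p) →
      ∀ m : ℤ, m = (n : ℤ) →
        IsAssociationScheme 5 ![A₀, A₁, A₂, A₃, A₄, A₅] ∧
        IsNonsymmetric (d := 5) ![A₀, A₁, A₂, A₃, A₄, A₅] ∧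
        A₁ᵀ = A₂ ∧ A₃.IsSymm ∧ A₄.IsSymm ∧ A₅.IsSymm ∧
        A₁ * A₁ = ((m - 1) * (2 * m - 1) * (2 * m ^ 2 - m)) • (A₁ + A₂ + A₃ + A₅)
          + (m ^ 2 * (2 * m - 1) ^ 2) • A₄ ∧
        A₂ * A₂ = ((m - 1) * (2 * m - 1) * (2 * m ^ 2 - m)) • (A₁ + A₂ + A₃ + A₅)
          + (m ^ 2 * (2 * m - 1) ^ 2) • A₄ ∧
        A₁ * A₂ = (m ^ 2 * (2 * m - 1) ^ 2) • A₀ + ((2 * m - 1) ^ 2 * (m ^ 2 - m)) • J ∧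
        A₁ * A₃ = (2 * m * (m - 1) * (2 * m - 1)) • (A₁ + A₂ + A₃)
          + (m * (2 * m - 1) ^ 2) • A₅ ∧
        A₂ * A₃ = (2 * m * (m - 1) * (2 * m - 1)) • (A₁ + A₂ + A₃)
          + (m * (2 * m - 1) ^ 2) • A₅ ∧
        A₁ * A₄ = (m - 1) • A₁ + m • A₂ ∧
        A₁ * A₅ = (2 * m * (m - 1)) • (A₁ + A₂) + (m * (2 * m - 1)) • A₃ ∧
        A₂ * A₅ = (2 * m * (m - 1)) • (A₁ + A₂) + (m * (2 * m - 1)) • A₃ ∧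
        A₂ * A₄ = m • A₁ + (m - 1) • A₂ ∧
        A₃ * A₃ = (2 * m * (2 * m - 1) ^ 2) • A₀ + (4 * m * (m - 1)) • (A₁ + A₂ + A₃)
          + (2 * m * (2 * m - 1) ^ 2) • A₄ ∧
        A₃ * A₄ = (2 * m - 1) • A₃ ∧
        A₃ * A₅ = (2 * m) • (A₁ + A₂) ∧
        A₄ * A₄ = (2 * m - 1) • A₀ + (2 * m - 2) • A₄ ∧
        A₄ * A₅ = (2 * m - 1) • A₅ ∧
        A₅ * A₅ = (2 * m * (2 * m - 1)) • A₀ + (2 * m * (2 * m - 1)) • A₄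
          + (4 * m * (m - 1)) • A₅ := by
  refine ⟨exists_isBGW_isSkewBGW hpn hp (even_of_isHadamard hpn hp hK), ?_⟩
  rintro W hW hs _ _ _ _ _ _ _ rfl rfl rfl rfl rfl rfl rfl _ rfl
  rw [matA3_eq hK hW hs, matA4_eq, matA5_eq]
  obtain ⟨hscheme, hplus⟩ := isAssociationScheme_twin hpn hp.two_le hK hW hs
  have ht := (twinRelations hpn hK hW hs).table (plusTwin_add_minusTwin hK hW hs)
    (plusTwin_sub_minusTwin hK hW hs)
  refine ⟨hscheme, fun h => ?_, plusTwin_transpose hs, zeroMatrix_transpose hs, ?_, ?_, ht.h11,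
    ht.h22, ht.h12, ht.h13, ht.h23, ht.h14, ht.h15, ht.h25, ht.h24, ht.h33, ht.h34, ht.h35,
    ht.h44, ht.h45, ht.h55⟩
  -- If A₁ were symmetric it would equal its transpose A₂; the two have disjoint supports, so A₁
  -- would be zero.
  · have h1 : plusTwin K W = minusTwin K W := (h 1).symm.trans (plusTwin_transpose hs)
    refine hplus (Matrix.ext fun x y => ?_)
    have h2 := congrFun (congrFun h1 x) y
    simp only [plusTwin, minusTwin, Matrix.of_apply, Matrix.zero_apply] at h2 ⊢
    split_ifs at h2 ⊢ <;> omega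
  · rw [Matrix.IsSymm, Matrix.transpose_sub, smallOnes_transpose, Matrix.transpose_one]
  · rw [Matrix.IsSymm, Matrix.transpose_sub, smallOnes_transpose, bigOnes_transpose]
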